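/- Let $H$ be a complex Hilbert space and $B(H)$ the algebra of bounded operators on it. For $\mathfrak V,\mathfrak W\subseteq B(H)$, the extended Haagerup tensor product $\mathfrak V\otimes^{eh}\mathfrak W$ consists of all formal series $\sum_{i\in I}v_i\otimes w_i$ with $v_i\in\mathfrak V$, $w_i\in\mathfrak W$ for which $\sum_i v_iv_i^*$ and $\sum_i w_i^*w_i$ converge weak* in $B(H)$. Such a series defines the linear operator $x\mapsto\sum_i v_ixw_i$ (weak* convergent) on $B(H)$, and two series are identified when these operators coincide; an element of $\mathfrak V\otimes^{eh}\mathfrak W$ is called positive, respectively completely positive, when its operator is. Let $\mathfrak A$ be an abelian C*-subalgebra of $B(H)$ (norm closed, not necessarily containing the identity), let $E$ be a locally compact space, and let $F:\mathfrak A\to C_b(E)$ be an injective $*$-homomorphism into the bounded continuous complex functions on $E$. For $T=\sum_i v_i\otimes w_i\in\mathfrak A\otimes^{eh}\mathfrak A$ let $u=(F\otimes F)T:E\times E\to\mathbb C$ be the function $$u(x,y)=\sum_{i\in I}F(v_i)(x)\,F(w_i)(y),$$ which does not depend on the series chosen to represent $T$. Then $u\in F(\mathfrak A)\otimes^{eh}F(\mathfrak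 A)$, regarded as a space of functions on $E\times E$; that is, $u(x,y)=\sum_i\varphi_i(x)\psi_i(y)$ for some families $\varphi_i,\psi_i\in F(\mathfrak A)$ such that $\sum_i|\varphi_i|^2$ and $\sum_i|\psi_i|^2$ are bounded on $E$. Moreover, the following are equivalent: (i) $T$ is positive; (ii) $T$ is completely positive; (iii) $u$ is positive definite, that is, for all $x_1,\dots,x_n\in E$ the matrix $[u(x_i,x_j)]$ is positive semidefinite. -/

import Mathlib

open scoped InnerProductSpace

universe u v

namespace ExtHaagerup

section Operators

set_option linter.unusedSectionVars false

variable {H : Type u} [NormedAddCommGroup H] [InnerProductSpace ℂ H] [CompleteSpace H]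

/-- The series `∑ i, a i` converges to `s` in the weak* topology of `B(H)` (the topology of `B(H)`
as the dual of the trace class operators): convergence is tested against every normal functional
`x ↦ ∑ n, ⟪η n, x (ξ n)⟫` with square summable sequences `ξ`, `η` in `H`. -/
def WeakStarHasSum {ι : Type*} (a : ι → H →L[ℂ] H) (s : H →L[ℂ] H) : Prop :=
  ∀ ξ η : ℕ → H, (Summable fun n => ‖ξ n‖ ^ 2) → (Summable fun n => ‖η n‖ ^ 2) →
    HasSum (fun i => ∑' n, ⟪η n, a i (ξ n)⟫_ℂ) (∑' n, ⟪η n, s (ξ n)⟫_ℂ)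

theorem summable_sq_single {H : Type u} [NormedAddCommGroup H] (ζ : H) :
    Summable fun n : ℕ => ‖(if n = 0 then ζ else 0 : H)‖ ^ 2 := by
  refine summable_of_ne_finset_zero (s := {0}) fun n hn => ?_
  simp at hn
  simp [hn]

theorem WeakStarHasSum.inner {ι : Type*} {a : ι → H →L[ℂ] H} {s : H →L[ℂ] H}
    (h : WeakStarHasSum a s) (η ξ : H) : HasSum (fun i => ⟪η, a i ξ⟫_ℂ) ⟪η, s ξ⟫_ℂ := by
  have key : ∀ x : H →L[ℂ] H,
      ∑' n : ℕ, ⟪(if n = 0 then η else 0 : H), x (if n = 0 then ξ else 0 : H)⟫_ℂ = ⟪η, x ξ⟫_ℂ := by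
    intro x
    rw [tsum_eq_single 0]
    · simp
    · intro n hn
      simp [hn]
  have := h _ _ (summable_sq_single ξ) (summable_sq_single η)
  simpa only [key] using this

theorem WeakStarHasSum.unique {ι : Type*} {a : ι → H →L[ℂ] H} {s t : H →L[ℂ] H}
    (h : WeakStarHasSum a s) (h' : WeakStarHasSum a t) : s = t := by
  ext ξ
  exact ext_inner_left ℂ fun η => (h.inner η ξ).unique (h'.inner η ξ)

/-- `b` is a bounded column: `∑ i, (b i)⋆ * b i` converges weak*. -/
def ColConv {ι : Type*} (b : ι → H →L[ℂ] H) : Prop :=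
  ∃ s, WeakStarHasSum (fun i => star (b i) * b i) s

/-- `b` is a bounded row: `∑ i, b i * (b i)⋆` converges weak*. -/
def RowConv {ι : Type*} (b : ι → H →L[ℂ] H) : Prop :=
  ∃ s, WeakStarHasSum (fun i => b i * star (b i)) s

theorem RowConv.colConv_star {ι : Type*} {b : ι → H →L[ℂ] H} (h : RowConv b) :
    ColConv fun i => star (b i) := by
  simpa [ColConv, RowConv] using h

theorem inner_star_mul_self (b : H →L[ℂ] H) (ζ : H) :
    ⟪ζ, (star b * b) ζ⟫_ℂ = ((‖b ζ‖ ^ 2 : ℝ) : ℂ) := by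
  rw [ContinuousLinearMap.star_eq_adjoint, mul_apply_eq_comp,
    ContinuousLinearMap.adjoint_inner_right, inner_self_eq_norm_sq_to_K]
  simp

theorem ColConv.bound {ι : Type*} {b : ι → H →L[ℂ] H} (h : ColConv b) :
    ∃ C : ℝ, 0 ≤ C ∧ ∀ (ζ : H) (t : Finset ι), ∑ i ∈ t, ‖b i ζ‖ ^ 2 ≤ C * ‖ζ‖ ^ 2 := by
  obtain ⟨s, hs⟩ := h
  refine ⟨‖s‖, norm_nonneg _, fun ζ t => ?_⟩
  have h1 := hs.inner ζ ζ
  simp only [inner_star_mul_self] at h1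
  have h2 := Complex.hasSum_re h1
  simp only [Complex.ofReal_re] at h2
  calc ∑ i ∈ t, ‖b i ζ‖ ^ 2 ≤ (⟪ζ, s ζ⟫_ℂ).re := sum_le_hasSum t (fun i _ => by positivity) h2
    _ ≤ ‖⟪ζ, s ζ⟫_ℂ‖ := Complex.re_le_norm _
    _ ≤ ‖ζ‖ * ‖s ζ‖ := norm_inner_le_norm _ _
    _ ≤ ‖ζ‖ * (‖s‖ * ‖ζ‖) := by gcongr; exact s.le_opNorm ζ
    _ = ‖s‖ * ‖ζ‖ ^ 2 := by ring

theorem ColConv.summable_prod {ι : Type*} {b : ι → H →L[ℂ] H} (h : ColConv b)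
    {ξ : ℕ → H} (hξ : Summable fun n => ‖ξ n‖ ^ 2) :
    Summable fun p : ι × ℕ => ‖b p.1 (ξ p.2)‖ ^ 2 := by
  obtain ⟨s, hs⟩ := h
  rw [summable_prod_of_nonneg (fun _ => by positivity)]
  refine ⟨fun i => ?_, ?_⟩
  · refine Summable.of_nonneg_of_le (fun _ => by positivity) (fun n => ?_)
      (hξ.mul_left (‖b i‖ ^ 2))
    rw [← mul_pow]
    exact pow_le_pow_left₀ (norm_nonneg _) ((b i).le_opNorm _) 2
  · have h1 := hs ξ ξ hξ hξ
    simp only [inner_star_mul_self, ← Complex.ofReal_tsum] at h1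
    have h2 := (Complex.hasSum_re h1).summable
    simpa using h2

/-- The column operator `ζ ↦ (b i ζ)ᵢ` into `ℓ²(ι, H)`. -/
theorem exists_column {ι : Type*} (b : ι → H →L[ℂ] H) {C : ℝ} (hC0 : 0 ≤ C)
    (hC : ∀ (ζ : H) (t : Finset ι), ∑ i ∈ t, ‖b i ζ‖ ^ 2 ≤ C * ‖ζ‖ ^ 2) :
    ∃ W : H →L[ℂ] lp (fun _ : ι => H) 2, ∀ ζ i, W ζ i = b i ζ := by
  have hm : ∀ ζ, Memℓp (fun i => b i ζ) 2 := fun ζ =>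
    memℓp_gen' (C := C * ‖ζ‖ ^ 2) (by simpa using hC ζ)
  let L : H →ₗ[ℂ] lp (fun _ : ι => H) 2 :=
    { toFun := fun ζ => ⟨fun i => b i ζ, hm ζ⟩
      map_add' := fun x y => by
        ext i
        rw [lp.coeFn_add, Pi.add_apply]
        exact map_add (b i) x y
      map_smul' := fun c x => by ext i; simp }
  refine ⟨L.mkContinuous (Real.sqrt C) fun ζ => ?_, fun ζ i => rfl⟩
  refine lp.norm_le_of_forall_sum_le (by simp) (by positivity) fun t => ?_
  have : (Real.sqrt C * ‖ζ‖) ^ 2 = C * ‖ζ‖ ^ 2 := by rw [mul_pow, Real.sq_sqrt hC0]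
  simpa [this, L] using hC ζ t

theorem exists_sandwich {ι : Type*} {v w : ι → H →L[ℂ] H} (hv : RowConv v) (hw : ColConv w)
    (x : H →L[ℂ] H) : ∃ s, WeakStarHasSum (fun i => v i * x * w i) s := by
  obtain ⟨C, hC0, hC⟩ := hv.colConv_star.bound
  obtain ⟨D, hD0, hD⟩ := hw.bound
  obtain ⟨V, hV⟩ := exists_column (fun i => star (v i)) hC0 hC
  have hle : ∀ (i : ι) (ζ : H), ‖(x * w i) ζ‖ ^ 2 ≤ ‖x‖ ^ 2 * ‖w i ζ‖ ^ 2 := fun i ζ => by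
    rw [← mul_pow]
    exact pow_le_pow_left₀ (norm_nonneg _) (x.le_opNorm _) 2
  obtain ⟨W, hW⟩ := exists_column (fun i => x * w i) (C := ‖x‖ ^ 2 * D) (by positivity)
    (fun ζ t => by
      calc ∑ i ∈ t, ‖(x * w i) ζ‖ ^ 2 ≤ ∑ i ∈ t, ‖x‖ ^ 2 * ‖w i ζ‖ ^ 2 :=
            Finset.sum_le_sum fun i _ => hle i ζ
        _ = ‖x‖ ^ 2 * ∑ i ∈ t, ‖w i ζ‖ ^ 2 := by rw [Finset.mul_sum]
        _ ≤ ‖x‖ ^ 2 * (D * ‖ζ‖ ^ 2) := by gcongr; exact hD ζ t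
        _ = _ := by ring)
  have hin : ∀ (i : ι) (η ξ : H), ⟪η, (v i * x * w i) ξ⟫_ℂ = ⟪star (v i) η, (x * w i) ξ⟫_ℂ := by
    intro i η ξ
    rw [ContinuousLinearMap.star_eq_adjoint, ContinuousLinearMap.adjoint_inner_left]
    rfl
  have hs : ∀ η ξ : H, HasSum (fun i => ⟪η, (v i * x * w i) ξ⟫_ℂ)
      ⟪η, (ContinuousLinearMap.adjoint V ∘L W) ξ⟫_ℂ := by
    intro η ξ
    have := lp.hasSum_inner (𝕜 := ℂ) (V η) (W ξ)
    simp only [hV, hW] at this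
    rw [ContinuousLinearMap.comp_apply, ContinuousLinearMap.adjoint_inner_right]
    simpa only [hin] using this
  refine ⟨ContinuousLinearMap.adjoint V ∘L W, fun ξ η hξ hη => ?_⟩
  have h1 := hv.colConv_star.summable_prod hη
  have h2 := hw.summable_prod hξ
  have hsum : Summable fun p : ι × ℕ => ⟪η p.2, (v p.1 * x * w p.1) (ξ p.2)⟫_ℂ := by
    refine Summable.of_norm_bounded (h1.add (h2.mul_left (‖x‖ ^ 2))) fun p => ?_
    rw [hin]
    have a1 := norm_inner_le_norm (𝕜 := ℂ) (star (v p.1) (η p.2)) ((x * w p.1) (ξ p.2))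
    have a2 := hle p.1 (ξ p.2)
    nlinarith [sq_nonneg (‖star (v p.1) (η p.2)‖ - ‖(x * w p.1) (ξ p.2)‖),
      sq_nonneg (‖star (v p.1) (η p.2)‖), sq_nonneg (‖(x * w p.1) (ξ p.2)‖)]
  have h3 := hsum.hasSum.prod_fiberwise fun i => (hsum.prod_factor i).hasSum
  have h4 : HasSum (fun n => ⟪η n, (ContinuousLinearMap.adjoint V ∘L W) (ξ n)⟫_ℂ)
      (∑' p : ι × ℕ, ⟪η p.2, (v p.1 * x * w p.1) (ξ p.2)⟫_ℂ) :=
    ((Equiv.prodComm ℕ ι).hasSum_iff.mpr hsum.hasSum).prod_fiberwise fun n => hs (η n) (ξ n)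
  rw [h4.tsum_eq]
  exact h3

/-- A formal series `∑ i, v i ⊗ w i` with `v i ∈ 𝒱`, `w i ∈ 𝒲` such that `∑ i, v i * (v i)⋆` and
`∑ i, (w i)⋆ * w i` converge weak* in `B(H)`. -/
structure Series {S S' : Type*} [SetLike S (H →L[ℂ] H)] [SetLike S' (H →L[ℂ] H)]
    (𝒱 : S) (𝒲 : S') where
  /-- the index set -/
  ι : Type u
  /-- the left entries -/
  left : ι → 𝒱
  /-- the right entries -/
  right : ι → 𝒲
  left_conv : RowConv fun i => (left i : H →L[ℂ] H)
  right_conv : ColConv fun i => (right i : H →L[ℂ] H)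

variable {S S' : Type*} [SetLike S (H →L[ℂ] H)] [SetLike S' (H →L[ℂ] H)] {𝒱 : S} {𝒲 : S'}

theorem Series.exists_op (t : Series 𝒱 𝒲) (x : H →L[ℂ] H) :
    ∃ s, WeakStarHasSum (fun i => (t.left i : H →L[ℂ] H) * x * (t.right i : H →L[ℂ] H)) s :=
  exists_sandwich t.left_conv t.right_conv x

/-- The value `∑ i, v i * x * w i` (weak* convergent). -/
noncomputable def Series.opFun (t : Series 𝒱 𝒲) (x : H →L[ℂ] H) : H →L[ℂ] H :=
  (t.exists_op x).choose

theorem Series.opFun_spec (t : Series 𝒱 𝒲) (x : H →L[ℂ] H) :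
    WeakStarHasSum (fun i => (t.left i : H →L[ℂ] H) * x * (t.right i : H →L[ℂ] H)) (t.opFun x) :=
  (t.exists_op x).choose_spec

/-- The operator `x ↦ ∑ i, v i * x * w i` on `B(H)` given by a formal series. -/
noncomputable def Series.op (t : Series 𝒱 𝒲) : (H →L[ℂ] H) →ₗ[ℂ] (H →L[ℂ] H) where
  toFun := t.opFun
  map_add' x y := by
    ext ξ
    refine ext_inner_left ℂ fun η => ?_
    refine ((t.opFun_spec (x + y)).inner η ξ).unique ?_
    have := ((t.opFun_spec x).inner η ξ).add ((t.opFun_spec y).inner η ξ)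
    simpa [mul_add, add_mul, inner_add_right] using this
  map_smul' c x := by
    ext ξ
    refine ext_inner_left ℂ fun η => ?_
    refine ((t.opFun_spec (c • x)).inner η ξ).unique ?_
    have := ((t.opFun_spec x).inner η ξ).mul_left c
    simpa [inner_smul_right] using this

theorem Series.op_spec (t : Series 𝒱 𝒲) (x : H →L[ℂ] H) :
    WeakStarHasSum (fun i => (t.left i : H →L[ℂ] H) * x * (t.right i : H →L[ℂ] H)) (t.op x) :=
  t.opFun_spec x

/-- Two formal series are identified when they give the same operator on `B(H)`. -/
def seriesSetoid (𝒱 : S) (𝒲 : S') : Setoid (Series 𝒱 𝒲) where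
  r t t' := ∀ x, t.op x = t'.op x
  iseqv := ⟨fun _ _ => rfl, fun h x => (h x).symm, fun h h' x => (h x).trans (h' x)⟩

/-- The extended Haagerup tensor product `𝒱 ⊗ᵉʰ 𝒲`. -/
def Tensor (𝒱 : S) (𝒲 : S') : Type _ := Quotient (seriesSetoid 𝒱 𝒲)

/-- The operator on `B(H)` with which an element of `𝒱 ⊗ᵉʰ 𝒲` is identified. -/
noncomputable def Tensor.op (T : Tensor 𝒱 𝒲) : (H →L[ℂ] H) →ₗ[ℂ] (H →L[ℂ] H) :=
  Quotient.lift Series.op (fun _ _ h => LinearMap.ext h) T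

end Operators

section Transform

variable {H : Type u} [NormedAddCommGroup H] [InnerProductSpace ℂ H] [CompleteSpace H]

theorem norm_sum_star_mul_self_le {ι : Type*} (b : ι → H →L[ℂ] H) {C : ℝ} (hC0 : 0 ≤ C)
    (hC : ∀ (ζ : H) (t : Finset ι), ∑ i ∈ t, ‖b i ζ‖ ^ 2 ≤ C * ‖ζ‖ ^ 2) (t : Finset ι) :
    ‖∑ i ∈ t, star (b i) * b i‖ ≤ C := by
  set A : H →L[ℂ] H := ∑ i ∈ t, star (b i) * b i with hA
  have hform : ∀ η ζ : H, ‖⟪η, A ζ⟫_ℂ‖ ≤ C * ‖η‖ * ‖ζ‖ := by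
    intro η ζ
    have h1 : ⟪η, A ζ⟫_ℂ = ∑ i ∈ t, ⟪b i η, b i ζ⟫_ℂ := by
      rw [hA, sum_apply, inner_sum]
      refine Finset.sum_congr rfl fun i _ => ?_
      rw [ContinuousLinearMap.star_eq_adjoint, mul_apply_eq_comp,
        ContinuousLinearMap.adjoint_inner_right]
    calc ‖⟪η, A ζ⟫_ℂ‖ ≤ ∑ i ∈ t, ‖b i η‖ * ‖b i ζ‖ := by
          rw [h1]
          exact norm_sum_le_of_le _ fun i _ => norm_inner_le_norm _ _
      _ ≤ Real.sqrt (∑ i ∈ t, ‖b i η‖ ^ 2) * Real.sqrt (∑ i ∈ t, ‖b i ζ‖ ^ 2) :=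
          Real.sum_mul_le_sqrt_mul_sqrt _ _ _
      _ ≤ Real.sqrt (C * ‖η‖ ^ 2) * Real.sqrt (C * ‖ζ‖ ^ 2) := by
          gcongr
          · exact hC η t
          · exact hC ζ t
      _ = C * ‖η‖ * ‖ζ‖ := by
          rw [Real.sqrt_mul hC0, Real.sqrt_mul hC0, Real.sqrt_sq (norm_nonneg _),
            Real.sqrt_sq (norm_nonneg _)]
          linear_combination (‖η‖ * ‖ζ‖) * Real.mul_self_sqrt hC0
  refine A.opNorm_le_bound hC0 fun ζ => ?_
  have h2 := hform (A ζ) ζ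
  rw [inner_self_eq_norm_sq_to_K] at h2
  simp only [norm_pow] at h2
  rcases (norm_nonneg (A ζ)).eq_or_lt with h0 | h0
  · rw [← h0]
    positivity
  · refine le_of_mul_le_mul_left ?_ h0
    calc ‖A ζ‖ * ‖A ζ‖ ≤ C * ‖A ζ‖ * ‖ζ‖ := by simpa [sq] using h2
      _ = ‖A ζ‖ * (C * ‖ζ‖) := by ring

/-- A square summable combination of the entries of a bounded column converges in norm. -/
theorem ColConv.summable_smul {ι : Type*} {b : ι → H →L[ℂ] H} (hb : ColConv b) {c : ι → ℂ}
    (hc : Summable fun i => ‖c i‖ ^ 2) : Summable fun i => c i • b i := by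
  obtain ⟨C, hC0, hC⟩ := hb.bound
  rw [summable_iff_vanishing_norm]
  intro ε hε
  have hδ : 0 < ε ^ 2 / (C + 1) := by positivity
  obtain ⟨s, hs⟩ := summable_iff_vanishing_norm.mp hc _ hδ
  refine ⟨s, fun t ht => ?_⟩
  have h1 := hs t ht
  rw [Real.norm_of_nonneg (Finset.sum_nonneg fun i _ => by positivity)] at h1
  have h2 : ‖∑ i ∈ t, c i • b i‖ ≤ Real.sqrt (∑ i ∈ t, ‖c i‖ ^ 2) * Real.sqrt C := by
    refine ContinuousLinearMap.opNorm_le_bound _ (by positivity) fun ζ => ?_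
    rw [sum_apply]
    calc ‖∑ i ∈ t, (c i • b i) ζ‖ ≤ ∑ i ∈ t, ‖c i‖ * ‖b i ζ‖ :=
          norm_sum_le_of_le _ fun i _ => by simp [norm_smul]
      _ ≤ Real.sqrt (∑ i ∈ t, ‖c i‖ ^ 2) * Real.sqrt (∑ i ∈ t, ‖b i ζ‖ ^ 2) :=
          Real.sum_mul_le_sqrt_mul_sqrt _ _ _
      _ ≤ Real.sqrt (∑ i ∈ t, ‖c i‖ ^ 2) * Real.sqrt (C * ‖ζ‖ ^ 2) := by
          gcongr
          exact hC ζ t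
      _ = _ := by rw [Real.sqrt_mul hC0, Real.sqrt_sq (norm_nonneg _), mul_assoc]
  refine h2.trans_lt ?_
  rw [← Real.sqrt_mul (Finset.sum_nonneg fun i _ => by positivity), Real.sqrt_lt' hε]
  have h3 : (∑ i ∈ t, ‖c i‖ ^ 2) * (C + 1) < ε ^ 2 := (lt_div_iff₀ (by positivity)).mp h1
  nlinarith [Finset.sum_nonneg (s := t) (f := fun i => ‖c i‖ ^ 2) fun i _ => by positivity]

theorem RowConv.summable_smul {ι : Type*} {b : ι → H →L[ℂ] H} (hb : RowConv b) {c : ι → ℂ}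
    (hc : Summable fun i => ‖c i‖ ^ 2) : Summable fun i => c i • b i := by
  have h1 := (hb.colConv_star.summable_smul (c := fun i => star (c i)) (by simpa using hc)).star
  simpa using h1

variable {E : Type v} [TopologicalSpace E] {𝔄 : NonUnitalStarSubalgebra ℂ (H →L[ℂ] H)}

theorem ColConv.summable_eval (h𝔄 : IsClosed (𝔄 : Set (H →L[ℂ] H)))
    (F : 𝔄 →⋆ₙₐ[ℂ] BoundedContinuousFunction E ℂ) {ι : Type*} {b : ι → 𝔄}
    (hb : ColConv fun i => (b i : H →L[ℂ] H)) :
    ∃ C : ℝ, ∀ (x : E) (t : Finset ι), ∑ i ∈ t, ‖F (b i) x‖ ^ 2 ≤ C := by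
  have : IsClosed (𝔄 : Set (H →L[ℂ] H)) := h𝔄
  obtain ⟨C, hC0, hC⟩ := hb.bound
  refine ⟨C, fun x t => ?_⟩
  have h1 : ((∑ i ∈ t, ‖F (b i) x‖ ^ 2 : ℝ) : ℂ) = F (∑ i ∈ t, star (b i) * b i) x := by
    rw [map_sum, BoundedContinuousFunction.sum_apply, Complex.ofReal_sum]
    refine Finset.sum_congr rfl fun i _ => ?_
    rw [map_mul, map_star, BoundedContinuousFunction.mul_apply,
      BoundedContinuousFunction.star_apply]
    simp [Complex.conj_mul']
  calc ∑ i ∈ t, ‖F (b i) x‖ ^ 2 = ‖((∑ i ∈ t, ‖F (b i) x‖ ^ 2 : ℝ) : ℂ)‖ := by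
        rw [Complex.norm_real, Real.norm_of_nonneg (Finset.sum_nonneg fun i _ => by positivity)]
    _ ≤ ‖F (∑ i ∈ t, star (b i) * b i)‖ := by
        rw [h1]
        exact BoundedContinuousFunction.norm_coe_le_norm _ _
    _ ≤ ‖∑ i ∈ t, star (b i) * b i‖ := NonUnitalStarAlgHom.norm_apply_le F _
    _ = ‖∑ i ∈ t, star (b i : H →L[ℂ] H) * (b i : H →L[ℂ] H)‖ := by
        change ‖((∑ i ∈ t, star (b i) * b i : 𝔄) : H →L[ℂ] H)‖ = _
        simp
    _ ≤ C := norm_sum_star_mul_self_le _ hC0 hC t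

theorem RowConv.summable_eval (h𝔄 : IsClosed (𝔄 : Set (H →L[ℂ] H)))
    (F : 𝔄 →⋆ₙₐ[ℂ] BoundedContinuousFunction E ℂ) {ι : Type*} {b : ι → 𝔄}
    (hb : RowConv fun i => (b i : H →L[ℂ] H)) :
    ∃ C : ℝ, ∀ (x : E) (t : Finset ι), ∑ i ∈ t, ‖F (b i) x‖ ^ 2 ≤ C := by
  obtain ⟨C, hC⟩ := ColConv.summable_eval h𝔄 F (b := fun i => star (b i)) (by simpa using hb.colConv_star)
  exact ⟨C, fun x t => by simpa [map_star] using hC x t⟩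

/-- Norm convergent series in `𝔄` may be evaluated termwise. -/
theorem hasSum_eval (h𝔄 : IsClosed (𝔄 : Set (H →L[ℂ] H)))
    (F : 𝔄 →⋆ₙₐ[ℂ] BoundedContinuousFunction E ℂ) {ι : Type*} {b : ι → 𝔄} {c : ι → ℂ}
    (h : Summable fun i => c i • (b i : H →L[ℂ] H)) :
    ∃ a : 𝔄, (a : H →L[ℂ] H) = ∑' i, c i • (b i : H →L[ℂ] H) ∧
      ∀ y, HasSum (fun i => c i * F (b i) y) (F a y) := by
  have : IsClosed (𝔄 : Set (H →L[ℂ] H)) := h𝔄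
  have hmem : ∑' i, c i • (b i : H →L[ℂ] H) ∈ (𝔄 : Set (H →L[ℂ] H)) :=
    h𝔄.mem_of_tendsto h.hasSum (Filter.Eventually.of_forall fun t =>
      sum_mem fun i _ => (c i • b i).2)
  refine ⟨⟨_, hmem⟩, rfl, fun y => ?_⟩
  have h1 : HasSum (fun i => c i • b i) (⟨_, hmem⟩ : 𝔄) := by
    rw [HasSum, tendsto_subtype_rng]
    refine h.hasSum.congr fun t => ?_
    simp
  have hF : Continuous F := AddMonoidHomClass.continuous_of_bound F 1 fun a => by
    simpa using NonUnitalStarAlgHom.norm_apply_le F a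
  have h2 := (h1.map F hF).map (BoundedContinuousFunction.evalCLM ℂ y)
    (BoundedContinuousFunction.evalCLM ℂ y).continuous
  refine h2.congr fun t => ?_
  simp [map_smul]

/-- The function `(x, y) ↦ ∑ i, F (v i) x * F (w i) y` of a formal series `∑ i, v i ⊗ w i`. -/
noncomputable def Series.eval (F : 𝔄 →⋆ₙₐ[ℂ] BoundedContinuousFunction E ℂ) (t : Series 𝔄 𝔄)
    (x y : E) : ℂ :=
  ∑' i, F (t.left i) x * F (t.right i) y

theorem summable_sq_of_bound {ι : Type*} {f : ι → ℂ} {C : ℝ}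
    (h : ∀ t : Finset ι, ∑ i ∈ t, ‖f i‖ ^ 2 ≤ C) : Summable fun i => ‖f i‖ ^ 2 :=
  summable_of_sum_le (fun _ => by positivity) h

theorem Series.summable_left_inner (t : Series 𝔄 𝔄) (θ ξ : H) :
    Summable fun i => ‖⟪θ, (t.left i : H →L[ℂ] H) ξ⟫_ℂ‖ ^ 2 := by
  obtain ⟨C, hC0, hC⟩ := t.left_conv.colConv_star.bound
  refine Summable.of_nonneg_of_le (fun _ => by positivity) (fun i => ?_)
    ((summable_of_sum_le (fun _ => by positivity) (hC θ)).mul_left (‖ξ‖ ^ 2))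
  rw [← mul_pow]
  refine pow_le_pow_left₀ (norm_nonneg _) ?_ 2
  rw [ContinuousLinearMap.star_eq_adjoint, ← ContinuousLinearMap.adjoint_inner_left, mul_comm]
  exact norm_inner_le_norm _ _

/-- The right entries summed against a vector functional of the left ones. -/
theorem Series.slice_right_eq (h𝔄 : IsClosed (𝔄 : Set (H →L[ℂ] H)))
    (F : 𝔄 →⋆ₙₐ[ℂ] BoundedContinuousFunction E ℂ) {t t' : Series 𝔄 𝔄}
    (h : ∀ x, t.op x = t'.op x) (θ ξ : H) (y : E) :
    ∑' i, ⟪θ, (t.left i : H →L[ℂ] H) ξ⟫_ℂ * F (t.right i) y =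
      ∑' i, ⟪θ, (t'.left i : H →L[ℂ] H) ξ⟫_ℂ * F (t'.right i) y := by
  have key : ∀ s : Series 𝔄 𝔄, ∃ a : 𝔄,
      (∀ η ζ : H, ⟪η, (a : H →L[ℂ] H) ζ⟫_ℂ =
        ⟪θ, s.op (InnerProductSpace.rankOne ℂ ξ η) ζ⟫_ℂ) ∧
      ∑' i, ⟪θ, (s.left i : H →L[ℂ] H) ξ⟫_ℂ * F (s.right i) y = F a y := by
    intro s
    have hs := s.right_conv.summable_smul (s.summable_left_inner θ ξ)
    obtain ⟨a, ha, hF⟩ := hasSum_eval h𝔄 F hs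
    refine ⟨a, fun η ζ => ?_, (hF y).tsum_eq⟩
    have h1 : HasSum (fun i => ⟪η, (⟪θ, (s.left i : H →L[ℂ] H) ξ⟫_ℂ •
        (s.right i : H →L[ℂ] H)) ζ⟫_ℂ) ⟪η, (a : H →L[ℂ] H) ζ⟫_ℂ := by
      rw [ha]
      exact (hs.hasSum.mapL (ContinuousLinearMap.apply ℂ H ζ)).mapL (innerSL ℂ η)
    refine h1.unique ?_
    have h2 := (s.op_spec (InnerProductSpace.rankOne ℂ ξ η)).inner θ ζ
    refine h2.congr fun t => Finset.sum_congr rfl fun i _ => ?_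
    simp [mul_comm]
  obtain ⟨a, ha, hF⟩ := key t
  obtain ⟨a', ha', hF'⟩ := key t'
  have : a = a' := by
    ext ζ
    exact ext_inner_left ℂ fun η => by rw [ha, ha', h]
  rw [hF, hF', this]

/-- The function of a formal series depends only on the operator that the series defines. -/
theorem Series.eval_eq (h𝔄 : IsClosed (𝔄 : Set (H →L[ℂ] H)))
    (F : 𝔄 →⋆ₙₐ[ℂ] BoundedContinuousFunction E ℂ) {t t' : Series 𝔄 𝔄}
    (h : ∀ x, t.op x = t'.op x) : t.eval F = t'.eval F := by
  funext x y
  have key : ∀ s : Series 𝔄 𝔄, ∃ a : 𝔄,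
      (∀ θ ξ : H, ⟪θ, (a : H →L[ℂ] H) ξ⟫_ℂ =
        ∑' i, ⟪θ, (s.left i : H →L[ℂ] H) ξ⟫_ℂ * F (s.right i) y) ∧ s.eval F x y = F a x := by
    intro s
    obtain ⟨C, hC⟩ := ColConv.summable_eval h𝔄 F s.right_conv
    have hs := s.left_conv.summable_smul (summable_sq_of_bound (hC y))
    obtain ⟨a, ha, hF⟩ := hasSum_eval h𝔄 F hs
    refine ⟨a, fun θ ξ => ?_, ?_⟩
    · have h1 : HasSum (fun i => ⟪θ, (F (s.right i) y • (s.left i : H →L[ℂ] H)) ξ⟫_ℂ)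
          ⟪θ, (a : H →L[ℂ] H) ξ⟫_ℂ := by
        rw [ha]
        exact (hs.hasSum.mapL (ContinuousLinearMap.apply ℂ H ξ)).mapL (innerSL ℂ θ)
      rw [← h1.tsum_eq]
      simp [mul_comm]
    · rw [← (hF x).tsum_eq, Series.eval]
      simp [mul_comm]
  obtain ⟨a, ha, hF⟩ := key t
  obtain ⟨a', ha', hF'⟩ := key t'
  have : a = a' := by
    ext ξ
    exact ext_inner_left ℂ fun θ => by rw [ha, ha', Series.slice_right_eq h𝔄 F h]
  rw [hF, hF', this]

/-- The map `F ⊗ F` on `𝔄 ⊗ᵉʰ 𝔄`, sending `∑ i, v i ⊗ w i` to the function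
`(x, y) ↦ ∑ i, F (v i) x * F (w i) y` on `E × E`. -/
noncomputable def Tensor.transform (h𝔄 : IsClosed (𝔄 : Set (H →L[ℂ] H)))
    (F : 𝔄 →⋆ₙₐ[ℂ] BoundedContinuousFunction E ℂ) (T : Tensor 𝔄 𝔄) : E → E → ℂ :=
  Quotient.lift (Series.eval F) (fun _ _ h => Series.eval_eq h𝔄 F h) T

end Transform

section Functions

variable {E : Type v}

/-- For a set `𝒞` of bounded continuous functions on `E`, the space `𝒞 ⊗ᵉʰ 𝒞` regarded as a space
of functions on `E × E`: all `(x, y) ↦ ∑ i, φ i x * ψ i y` with `φ i, ψ i ∈ 𝒞` such that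
`∑ i, |φ i|²` and `∑ i, |ψ i|²` are bounded on `E`. -/
def tensorFunctions [TopologicalSpace E] (𝒞 : Set (BoundedContinuousFunction E ℂ)) :
    Set (E → E → ℂ) :=
  {u | ∃ (ι : Type u) (φ ψ : ι → BoundedContinuousFunction E ℂ),
    (∀ i, φ i ∈ 𝒞) ∧ (∀ i, ψ i ∈ 𝒞) ∧
    (∃ C : ℝ, ∀ (x : E) (t : Finset ι), ∑ i ∈ t, ‖φ i x‖ ^ 2 ≤ C) ∧
    (∃ C : ℝ, ∀ (x : E) (t : Finset ι), ∑ i ∈ t, ‖ψ i x‖ ^ 2 ≤ C) ∧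
    ∀ x y, HasSum (fun i => φ i x * ψ i y) (u x y)}

open scoped ComplexOrder in
/-- `u` is positive definite: each matrix `[u (x i) (x j)]` is of positive type. -/
def IsPositiveDefinite (u : E → E → ℂ) : Prop :=
  ∀ (n : ℕ) (x : Fin n → E), (Matrix.of fun i j => u (x i) (x j)).PosSemidef

end Functions

section Positivity

variable {A : Type*} [NonUnitalCStarAlgebra A] [PartialOrder A] [StarOrderedRing A]

/-- `L` maps positive elements to positive elements. -/
def IsPositiveMap (L : A →ₗ[ℂ] A) : Prop := ∀ a, 0 ≤ a → 0 ≤ L a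

/-- `L` is completely positive. -/
def IsCompletelyPositiveMap (L : A →ₗ[ℂ] A) : Prop :=
  ∃ Φ : CompletelyPositiveMap A A, Φ.toLinearMap = L

end Positivity

end ExtHaagerup

/-! A series `∑ v_i ⊗ w_i` carries a sesquilinear form on the dual of `𝔄`, `B(μ, ν) = ∑ μ(v_i)
conj(ν(w_i*))`, and conditions (i) and (iii) are each equivalent to `B(μ, μ) ≥ 0` for every `μ`.
Evaluations give `B(ev_x, ev_y) = u(x, y)`; the vector functional `μ = ⟪ξ, · ζ⟫` gives `B(μ, μ) =
⟪ξ, T(ζ ⊗ ζ*) ξ⟫`. Either family of functionals spans a norming subspace of the dual: vector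
functionals by the definition of the operator norm, evaluations because an injective
`*`-homomorphism is isometric. The row and column conditions make `B` bounded and weak* continuous
in each variable separately. `IsNorming.apply_self_nonneg` then spreads positivity from a norming
subspace to the whole dual. Separate continuity does not allow a limit in both variables at once, so
a minimization over a convex set of approximants replaces it. Positivity on single vector
functionals is weaker than positivity on their span, and commutativity of `𝔄` closes the gap. The
operator of `T` is a bimodule map over the commutant `𝔄'`, which contains its own commutant. Hence
finitely many vectors lie in one cyclic subspace of `𝔄'`, and a matrix inequality reduces to
positivity of `T` at one operator `∑ a_p* X_pq a_q`. This gives `B ≥ 0` on the span, and also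
complete positivity. Conversely, `B ≥ 0` makes `T` positive on rank one operators, and expanding
`z*z` along a Hilbert basis gives positivity everywhere. -/

namespace ExtHaagerup

/-! ### Norming subspaces and extension of positivity to the whole dual -/

section Norming

open scoped ComplexOrder ComplexConjugate

variable {V : Type*} [NormedAddCommGroup V] [NormedSpace ℂ V]

/-- A subspace of the dual of `V` that determines the norm of `V`. -/
def IsNorming (P : Submodule ℂ (StrongDual ℂ V)) : Prop :=
  ∀ (d : V) (c : ℝ), 0 ≤ c → (∀ ν ∈ P, ‖ν d‖ ≤ c * ‖ν‖) → ‖d‖ ≤ c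

/-- Bounded weak* approximation on two vectors by functionals from a norming subspace. -/
theorem IsNorming.exists_approx {P : Submodule ℂ (StrongDual ℂ V)} (hP : IsNorming P)
    (μ : StrongDual ℂ V) (a b : V) {ε : ℝ} (hε : 0 < ε) :
    ∃ ν ∈ P, ‖ν‖ ≤ ‖μ‖ ∧ ‖ν a - μ a‖ < ε ∧ ‖ν b - μ b‖ < ε := by
  let K : Set (ℂ × ℂ) := (fun ν : StrongDual ℂ V => (ν a, ν b)) '' {ν | ν ∈ P ∧ ‖ν‖ ≤ ‖μ‖}
  suffices h : (μ a, μ b) ∈ closure K by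
    obtain ⟨_, ⟨ν, ⟨hν, hn⟩, rfl⟩, hd⟩ := Metric.mem_closure_iff.mp h ε hε
    rw [dist_comm, Prod.dist_eq, max_lt_iff, dist_eq_norm, dist_eq_norm] at hd
    exact ⟨ν, hν, hn, hd.1, hd.2⟩
  by_contra hnot
  have hK : Convex ℝ K := by
    rintro _ ⟨ν, ⟨hν, hn⟩, rfl⟩ _ ⟨ν', ⟨hν', hn'⟩, rfl⟩ s t hs ht hst
    refine ⟨(s : ℂ) • ν + (t : ℂ) • ν', ⟨P.add_mem (P.smul_mem _ hν) (P.smul_mem _ hν'), ?_⟩, ?_⟩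
    · calc ‖(s : ℂ) • ν + (t : ℂ) • ν'‖ ≤ ‖(s : ℂ) • ν‖ + ‖(t : ℂ) • ν'‖ := norm_add_le _ _
        _ = s * ‖ν‖ + t * ‖ν'‖ := by
          rw [norm_smul, norm_smul, Complex.norm_of_nonneg hs, Complex.norm_of_nonneg ht]
        _ ≤ s * ‖μ‖ + t * ‖μ‖ := by gcongr
        _ = ‖μ‖ := by rw [← add_mul, hst, one_mul]
    · ext <;> simp
  -- A functional on `ℂ × ℂ` applied to `(ν a, ν b)` is `ν` at one vector `d`. Separation bounds `Re
  -- ν(d)` by `r` on the ball of `P`, so norming gives `‖d‖ ≤ r / ‖μ‖`, against `Re μ(d) > r`.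
  obtain ⟨f, r, hf, hr⟩ := RCLike.geometric_hahn_banach_closed_point (𝕜 := ℂ) hK.closure
    isClosed_closure hnot
  have hfd : ∀ ν : StrongDual ℂ V, f (ν a, ν b) = ν (f (1, 0) • a + f (0, 1) • b) := by
    intro ν
    have : ((ν a, ν b) : ℂ × ℂ) = ν a • (1, 0) + ν b • (0, 1) := by ext <;> simp
    rw [this, map_add, map_smul, map_smul, map_add, map_smul, map_smul]
    simp [mul_comm]
  set d := f (1, 0) • a + f (0, 1) • b
  rw [hfd] at hr
  have hlt : ∀ ν ∈ P, ‖ν‖ ≤ ‖μ‖ → (ν d).re < r := fun ν hν hn => by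
    have := hf _ (subset_closure ⟨ν, ⟨hν, hn⟩, rfl⟩)
    rwa [hfd] at this
  have h0 : 0 < r := by simpa using hlt 0 P.zero_mem (by simp)
  have hμ : 0 < ‖μ‖ := by
    rcases (norm_nonneg μ).eq_or_lt with h | h
    · rw [eq_comm, norm_eq_zero] at h
      simp [h] at hr
      linarith
    · exact h
  have hd : ‖d‖ ≤ r / ‖μ‖ := by
    refine hP d _ (by positivity) fun ν hν => ?_
    rcases (norm_nonneg ν).eq_or_lt with h | h
    · rw [eq_comm, norm_eq_zero] at h
      simp [h]
    obtain ⟨c, hc, hcd⟩ := RCLike.exists_norm_eq_mul_self (ν d)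
    have h1 := hlt (((‖μ‖ / ‖ν‖ : ℝ) : ℂ) • c • ν) (P.smul_mem _ (P.smul_mem _ hν)) (by
      rw [norm_smul, norm_smul, hc, Complex.norm_of_nonneg (by positivity), one_mul,
        div_mul_cancel₀ _ h.ne'])
    have h2 : (((‖μ‖ / ‖ν‖ : ℝ) : ℂ) • c • ν) d = ((‖μ‖ / ‖ν‖ * ‖ν d‖ : ℝ) : ℂ) := by
      rw [smul_apply, smul_apply, smul_eq_mul, smul_eq_mul, ← hcd]
      push_cast
      rfl
    rw [h2, Complex.ofReal_re] at h1
    rw [div_mul_eq_mul_div, div_lt_iff₀ h] at h1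
    rw [div_mul_eq_mul_div, le_div_iff₀ hμ]
    linarith
  have h3 : (μ d).re ≤ ‖μ‖ * ‖d‖ := (Complex.re_le_norm _).trans (μ.le_opNorm d)
  rw [le_div_iff₀ hμ] at hd
  change r < (μ d).re at hr
  linarith

variable {B : StrongDual ℂ V →ₗ[ℂ] StrongDual ℂ V →ₗ⋆[ℂ] ℂ}
  {P : Submodule ℂ (StrongDual ℂ V)}

/-- Polarization: the form is real at `μ`, `ν`, `μ + ν` and `μ + iν`. -/
theorem conj_apply_of_nonneg (hB : ∀ ν ∈ P, 0 ≤ B ν ν) {μ ν : StrongDual ℂ V} (hμ : μ ∈ P)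
    (hν : ν ∈ P) : conj (B ν μ) = B μ ν := by
  have h1 := (Complex.nonneg_iff.mp (hB _ hμ)).2
  have h2 := (Complex.nonneg_iff.mp (hB _ hν)).2
  have h3 := (Complex.nonneg_iff.mp (hB _ (P.add_mem hμ hν))).2
  have h4 := (Complex.nonneg_iff.mp (hB _ (P.add_mem hμ (P.smul_mem Complex.I hν)))).2
  simp only [map_add, LinearMap.add_apply, map_smul, LinearMap.smul_apply, LinearMap.map_smulₛₗ,
    Complex.add_im, smul_eq_mul, Complex.mul_im, Complex.I_re, Complex.I_im, Complex.conj_I,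
    Complex.neg_re, Complex.neg_im] at h3 h4
  apply Complex.ext
  · simp only [Complex.conj_re]
    simp at h4
    linarith
  · simp only [Complex.conj_im]
    linarith

/-- Hermitian symmetry passes from a norming subspace to the whole dual. -/
theorem IsNorming.conj_apply (hP : IsNorming P) (hB : ∀ ν ∈ P, 0 ≤ B ν ν)
    (ha : ∀ ν, ∃ a, ∀ μ, B μ ν = μ a) (hb : ∀ μ, ∃ b, ∀ ν, B μ ν = conj (ν b))
    (μ ν : StrongDual ℂ V) : conj (B ν μ) = B μ ν := by
  have step : ∀ lam : StrongDual ℂ V, (∀ ρ ∈ P, conj (B ρ lam) = B lam ρ) →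
      ∀ κ, conj (B κ lam) = B lam κ := by
    intro lam h κ
    obtain ⟨a, ha⟩ := ha lam
    obtain ⟨b, hb⟩ := hb lam
    refine eq_of_forall_dist_le fun ε hε => ?_
    obtain ⟨ρ, hρ, -, h1, h2⟩ := hP.exists_approx κ a b (half_pos hε)
    have h3 := h ρ hρ
    rw [ha, hb, ← sub_eq_zero] at h3
    rw [ha, hb, dist_eq_norm]
    have h4 : conj (κ a) - conj (κ b) = -conj (ρ a - κ a) + conj (ρ b - κ b) := by
      simp only [map_sub]
      linear_combination h3
    rw [h4]
    refine (norm_add_le _ _).trans ?_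
    rw [norm_neg, RCLike.norm_conj, RCLike.norm_conj]
    linarith
  -- Two rounds: the first frees one argument from `P`, and its conclusion is the hypothesis needed
  -- to free the other.
  have h1 : ∀ lam ∈ P, ∀ κ, conj (B κ lam) = B lam κ := fun lam hlam =>
    step lam fun ρ hρ => conj_apply_of_nonneg hB hlam hρ
  exact step μ (fun ρ hρ => by rw [← h1 ρ hρ μ, Complex.conj_conj]) ν

/-- Positivity of a bounded, separately weak* continuous sesquilinear form passes from a norming
subspace to the whole dual. -/
theorem IsNorming.apply_self_nonneg (hP : IsNorming P) (hB : ∀ ν ∈ P, 0 ≤ B ν ν)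
    (ha : ∀ ν, ∃ a, ∀ μ, B μ ν = μ a) (hb : ∀ μ, ∃ b, ∀ ν, B μ ν = conj (ν b))
    {C : ℝ} (hC : ∀ ν, ‖B ν ν‖ ≤ C * ‖ν‖ ^ 2) (μ : StrongDual ℂ V) : 0 ≤ B μ μ := by
  have hherm := hP.conj_apply hB ha hb
  refine Complex.nonneg_iff.mpr ⟨?_, ?_⟩
  swap
  · have := congrArg Complex.im (hherm μ μ)
    rw [Complex.conj_im] at this
    linarith
  by_contra! hneg
  obtain ⟨a, ha'⟩ := ha μ
  set δ : ℝ := -(B μ μ).re with hδdef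
  have hδ : 0 < δ := by linarith
  -- A convex set of approximants to `μ` that remember the negativity of `B μ μ` through their
  -- pairing with `μ`.
  let S : Set (StrongDual ℂ V) := {ν | ν ∈ P ∧ ‖ν‖ ≤ ‖μ‖ ∧ (B ν μ).re < -(δ / 2)}
  have happ : ∀ b : V, ∀ ε > 0, ∃ ν ∈ S, ‖ν b - μ b‖ < ε := by
    intro b ε hε
    obtain ⟨ν, hν, hn, h1, h2⟩ := hP.exists_approx μ a b (lt_min hε (half_pos hδ))
    refine ⟨ν, ⟨hν, hn, ?_⟩, h2.trans_le (min_le_left _ _)⟩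
    have h3 := (Complex.abs_re_le_norm _).trans_lt (h1.trans_le (min_le_right _ _))
    rw [← ha', ← ha', Complex.sub_re] at h3
    have := (abs_lt.mp h3).2
    linarith
  have hpos : ∀ ν ∈ S, 0 ≤ (B ν ν).re := fun ν hν => (Complex.nonneg_iff.mp (hB ν hν.1)).1
  set D : ℝ := |C| * ‖μ‖ ^ 2 with hD
  have hD0 : 0 ≤ D := by positivity
  have hle : ∀ ν ∈ S, (B ν ν).re ≤ D := fun ν hν =>
    ((Complex.re_le_norm _).trans (hC ν)).trans (by
      have := hν.2.1
      have := le_abs_self C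
      rw [hD]
      gcongr)
  have hbdd : BddBelow ((fun ν => (B ν ν).re) '' S) :=
    ⟨0, by rintro _ ⟨ν, hν, rfl⟩; exact hpos ν hν⟩
  obtain ⟨ν₁, hν₁, -⟩ := happ 0 1 one_pos
  set m := sInf ((fun ν => (B ν ν).re) '' S) with hm
  -- Small enough that the quadratic cost `t² D` is at most `tδ/8`, while `1 - t ≥ 1/2` keeps the
  -- cross term of size `tδ/2`.
  set t : ℝ := min (1 / 2) (δ / (8 * (D + 1))) with ht
  have ht0 : 0 < t := lt_min (by norm_num) (by positivity)
  have ht1 : t ≤ 1 / 2 := min_le_left _ _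
  have ht2 : t * D ≤ δ / 8 := by
    have h1 : t ≤ δ / (8 * (D + 1)) := min_le_right _ _
    rw [le_div_iff₀ (by positivity)] at h1
    nlinarith
  -- Take `ν₀` nearly minimal on `S`, then `ν ∈ S` close to `μ` at the vector representing `B ν₀`.
  -- Both cross terms are then below `-δ/2`, so moving from `ν₀` towards `ν` inside `S` lowers the
  -- form.
  obtain ⟨_, ⟨ν₀, hν₀, rfl⟩, hlt⟩ := Real.lt_sInf_add_pos (s := (fun ν => (B ν ν).re) '' S)
    ⟨_, ν₁, hν₁, rfl⟩ (ε := t * δ / 8) (by positivity)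
  simp only at hlt
  rw [← hm] at hlt
  obtain ⟨b, hb'⟩ := hb ν₀
  have hgap : 0 < -(δ / 2) - (B ν₀ μ).re := by
    have := hν₀.2.2
    linarith
  obtain ⟨ν, hν, hνb⟩ := happ b _ hgap
  have h5 : (B ν₀ ν).re < -(δ / 2) := by
    have h6 : ‖B ν₀ ν - B ν₀ μ‖ < -(δ / 2) - (B ν₀ μ).re := by
      have h8 : B ν₀ ν - B ν₀ μ = conj (ν b - μ b) := by rw [hb', hb', map_sub]
      rw [h8, RCLike.norm_conj]
      exact hνb
    have h7 := (Complex.abs_re_le_norm _).trans_lt h6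
    rw [Complex.sub_re] at h7
    have := (abs_lt.mp h7).2
    linarith
  have h5' : (B ν ν₀).re < -(δ / 2) := by
    rw [← hherm, Complex.conj_re]
    exact h5
  set κ : StrongDual ℂ V := ((1 - t : ℝ) : ℂ) • ν₀ + ((t : ℝ) : ℂ) • ν with hκ
  have hκS : κ ∈ S := by
    refine ⟨P.add_mem (P.smul_mem _ hν₀.1) (P.smul_mem _ hν.1), ?_, ?_⟩
    · calc ‖κ‖ ≤ ‖((1 - t : ℝ) : ℂ) • ν₀‖ + ‖((t : ℝ) : ℂ) • ν‖ := norm_add_le _ _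
        _ = (1 - t) * ‖ν₀‖ + t * ‖ν‖ := by
          rw [norm_smul, norm_smul, Complex.norm_of_nonneg (by linarith),
            Complex.norm_of_nonneg ht0.le]
        _ ≤ (1 - t) * ‖μ‖ + t * ‖μ‖ := by
          have := hν₀.2.1
          have := hν.2.1
          have : 0 ≤ 1 - t := by linarith
          gcongr
        _ = ‖μ‖ := by ring
    · have h8 := hν₀.2.2
      have h9 := hν.2.2
      simp only [hκ, map_add, LinearMap.add_apply, map_smul, LinearMap.smul_apply, smul_eq_mul,
        Complex.add_re, Complex.re_ofReal_mul]
      nlinarith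
  have hmκ : m ≤ (B κ κ).re := csInf_le hbdd ⟨κ, hκS, rfl⟩
  have hexp : (B κ κ).re = (1 - t) ^ 2 * (B ν₀ ν₀).re + t ^ 2 * (B ν ν).re +
      t * (1 - t) * ((B ν₀ ν).re + (B ν ν₀).re) := by
    simp only [hκ, map_add, LinearMap.add_apply, map_smul, LinearMap.smul_apply,
      LinearMap.map_smulₛₗ, smul_eq_mul, Complex.conj_ofReal, Complex.add_re,
      Complex.re_ofReal_mul]
    ring
  have h10 := hpos ν₀ hν₀
  have h11 := hle ν hν
  have h12 : (1 - t) ^ 2 * (B ν₀ ν₀).re ≤ (B ν₀ ν₀).re :=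
    mul_le_of_le_one_left h10 (by nlinarith)
  have h13 : t ^ 2 * (B ν ν).re ≤ t * (δ / 8) := by nlinarith
  have h14 : t * (1 - t) * ((B ν₀ ν).re + (B ν ν₀).re) ≤ t * (1 - t) * (-δ) :=
    mul_le_mul_of_nonneg_left (by linarith) (mul_nonneg ht0.le (by linarith))
  -- Altogether `m ≤ Re B κ κ < m + tδ/8 + tδ/8 - tδ/2`, which is absurd.
  nlinarith [mul_pos ht0 hδ]

end Norming

/-! ### The form of a pair of `ℓ²`-bounded families -/

section DualForm

open scoped ComplexOrder ComplexConjugate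

variable {V : Type*} [NormedAddCommGroup V] [NormedSpace ℂ V] {ι : Type*} {a b : ι → V}

/-- The combinations of the family `b` are bounded by the `ℓ²` norm of the coefficients. -/
def L2Bounded (b : ι → V) : Prop :=
  ∃ C : ℝ, 0 ≤ C ∧ ∀ (t : Finset ι) (c : ι → ℂ),
    ‖∑ i ∈ t, c i • b i‖ ≤ Real.sqrt (∑ i ∈ t, ‖c i‖ ^ 2) * Real.sqrt C

theorem L2Bounded.summable_smul [CompleteSpace V] (hb : L2Bounded b) {c : ι → ℂ}
    (hc : Summable fun i => ‖c i‖ ^ 2) : Summable fun i => c i • b i := by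
  obtain ⟨C, hC0, hC⟩ := hb
  rw [summable_iff_vanishing_norm]
  intro ε hε
  have hδ : 0 < ε ^ 2 / (C + 1) := by positivity
  obtain ⟨s, hs⟩ := summable_iff_vanishing_norm.mp hc _ hδ
  refine ⟨s, fun t ht => (hC t c).trans_lt ?_⟩
  have h0 : 0 ≤ ∑ i ∈ t, ‖c i‖ ^ 2 := Finset.sum_nonneg fun i _ => by positivity
  have h1 := hs t ht
  rw [Real.norm_of_nonneg h0] at h1
  rw [← Real.sqrt_mul h0, Real.sqrt_lt' hε]
  have h3 : (∑ i ∈ t, ‖c i‖ ^ 2) * (C + 1) < ε ^ 2 := (lt_div_iff₀ (by positivity)).mp h1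
  nlinarith

/-- Duality: testing `μ` on the combination with coefficients `conj (μ (b i))` gives `S ≤ ‖μ‖ √S
√C`, and one factor `√S` cancels. -/
theorem L2Bounded.sum_sq_le (hb : L2Bounded b) :
    ∃ C : ℝ, 0 ≤ C ∧ ∀ (μ : StrongDual ℂ V) (t : Finset ι),
      ∑ i ∈ t, ‖μ (b i)‖ ^ 2 ≤ C * ‖μ‖ ^ 2 := by
  obtain ⟨C, hC0, hC⟩ := hb
  refine ⟨C, hC0, fun μ t => ?_⟩
  set S := ∑ i ∈ t, ‖μ (b i)‖ ^ 2 with hS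
  have hS0 : 0 ≤ S := Finset.sum_nonneg fun i _ => by positivity
  have h1 : (S : ℂ) = μ (∑ i ∈ t, conj (μ (b i)) • b i) := by
    rw [map_sum, hS, Complex.ofReal_sum]
    refine Finset.sum_congr rfl fun i _ => ?_
    rw [map_smul, smul_eq_mul, Complex.conj_mul']
    simp
  have h2 : S ≤ ‖μ‖ * (Real.sqrt S * Real.sqrt C) := by
    calc S = ‖(S : ℂ)‖ := by rw [Complex.norm_of_nonneg hS0]
      _ ≤ ‖μ‖ * ‖∑ i ∈ t, conj (μ (b i)) • b i‖ := by rw [h1]; exact μ.le_opNorm _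
      _ ≤ _ := by
        gcongr
        simpa [hS] using hC t fun i => conj (μ (b i))
  rcases hS0.eq_or_lt with h | h
  · rw [← h]
    positivity
  have h3 : 0 < Real.sqrt S := Real.sqrt_pos.mpr h
  have h4 : Real.sqrt S * Real.sqrt S = S := Real.mul_self_sqrt hS0
  have h5 : Real.sqrt C * Real.sqrt C = C := Real.mul_self_sqrt hC0
  have h6 : Real.sqrt S ≤ ‖μ‖ * Real.sqrt C := by
    refine le_of_mul_le_mul_left ?_ h3
    linarith
  calc S = Real.sqrt S * Real.sqrt S := h4.symm
    _ ≤ (‖μ‖ * Real.sqrt C) * (‖μ‖ * Real.sqrt C) := by gcongr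
    _ = C * ‖μ‖ ^ 2 := by linear_combination ‖μ‖ ^ 2 * h5

theorem L2Bounded.summable_sq (hb : L2Bounded b) (μ : StrongDual ℂ V) :
    Summable fun i => ‖μ (b i)‖ ^ 2 := by
  obtain ⟨C, -, hC⟩ := hb.sum_sq_le
  exact summable_of_sum_le (fun _ => by positivity) (hC μ)

theorem summable_mul_conj {f g : ι → ℂ} (hf : Summable fun i => ‖f i‖ ^ 2)
    (hg : Summable fun i => ‖g i‖ ^ 2) : Summable fun i => f i * conj (g i) := by
  refine Summable.of_norm_bounded (hf.add hg) fun i => ?_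
  rw [norm_mul, RCLike.norm_conj]
  nlinarith [sq_nonneg (‖f i‖ - ‖g i‖), sq_nonneg ‖f i‖, sq_nonneg ‖g i‖]

/-- The form `(μ, ν) ↦ ∑ i, μ (a i) * conj (ν (b i))` on the dual of `V`. -/
noncomputable def dualForm (ha : L2Bounded a) (hb : L2Bounded b) :
    StrongDual ℂ V →ₗ[ℂ] StrongDual ℂ V →ₗ⋆[ℂ] ℂ :=
  LinearMap.mk₂'ₛₗ (RingHom.id ℂ) (starRingEnd ℂ) (fun μ ν => ∑' i, μ (a i) * conj (ν (b i)))
    (fun μ μ' ν => by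
      rw [← (summable_mul_conj (ha.summable_sq μ) (hb.summable_sq ν)).tsum_add
        (summable_mul_conj (ha.summable_sq μ') (hb.summable_sq ν))]
      simp [add_mul])
    (fun c μ ν => by simp [← tsum_mul_left, mul_assoc])
    (fun μ ν ν' => by
      rw [← (summable_mul_conj (ha.summable_sq μ) (hb.summable_sq ν)).tsum_add
        (summable_mul_conj (ha.summable_sq μ) (hb.summable_sq ν'))]
      simp [mul_add])
    (fun c μ ν => by simp [← tsum_mul_left, mul_left_comm])

variable (ha : L2Bounded a) (hb : L2Bounded b)

theorem dualForm_hasSum (μ ν : StrongDual ℂ V) :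
    HasSum (fun i => μ (a i) * conj (ν (b i))) (dualForm ha hb μ ν) :=
  (summable_mul_conj (ha.summable_sq μ) (hb.summable_sq ν)).hasSum

/-- Together with `dualForm_right` this is separate weak* continuity: square summable coefficients
make the representing series converge in norm. -/
theorem dualForm_left [CompleteSpace V] (ν : StrongDual ℂ V) :
    ∃ d : V, ∀ μ, dualForm ha hb μ ν = μ d := by
  have hs := ha.summable_smul (c := fun i => conj (ν (b i))) (by simpa using hb.summable_sq ν)
  refine ⟨∑' i, conj (ν (b i)) • a i, fun μ => (dualForm_hasSum ha hb μ ν).unique ?_⟩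
  have := hs.hasSum.mapL μ
  simpa [mul_comm] using this

theorem dualForm_right [CompleteSpace V] (μ : StrongDual ℂ V) :
    ∃ d : V, ∀ ν, dualForm ha hb μ ν = conj (ν d) := by
  have hs := hb.summable_smul (c := fun i => conj (μ (a i))) (by simpa using ha.summable_sq μ)
  refine ⟨∑' i, conj (μ (a i)) • b i, fun ν => (dualForm_hasSum ha hb μ ν).unique ?_⟩
  have := (hs.hasSum.mapL ν).star
  simpa using this

theorem dualForm_bound : ∃ C : ℝ, ∀ ν, ‖dualForm ha hb ν ν‖ ≤ C * ‖ν‖ ^ 2 := by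
  obtain ⟨C, hC0, hC⟩ := ha.sum_sq_le
  obtain ⟨D, hD0, hD⟩ := hb.sum_sq_le
  refine ⟨C + D, fun ν => ?_⟩
  refine le_of_tendsto (dualForm_hasSum ha hb ν ν).norm (Filter.Eventually.of_forall fun t => ?_)
  calc ‖∑ i ∈ t, ν (a i) * conj (ν (b i))‖ ≤ ∑ i ∈ t, (‖ν (a i)‖ ^ 2 + ‖ν (b i)‖ ^ 2) := by
        refine norm_sum_le_of_le _ fun i _ => ?_
        rw [norm_mul, RCLike.norm_conj]
        nlinarith [sq_nonneg (‖ν (a i)‖ - ‖ν (b i)‖), sq_nonneg ‖ν (a i)‖, sq_nonneg ‖ν (b i)‖]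
    _ ≤ C * ‖ν‖ ^ 2 + D * ‖ν‖ ^ 2 := by
        rw [Finset.sum_add_distrib]
        exact add_le_add (hC ν t) (hD ν t)
    _ = _ := by ring

theorem IsNorming.dualForm_nonneg [CompleteSpace V] {P : Submodule ℂ (StrongDual ℂ V)}
    (hP : IsNorming P) (h : ∀ ν ∈ P, 0 ≤ dualForm ha hb ν ν) (μ : StrongDual ℂ V) :
    0 ≤ dualForm ha hb μ μ := by
  obtain ⟨C, hC⟩ := dualForm_bound ha hb
  exact hP.apply_self_nonneg h (dualForm_left ha hb) (dualForm_right ha hb) hC μ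

theorem dualForm_sum_smul {κ : Type*} (s : Finset κ) (c d : κ → ℂ) (μ ν : κ → StrongDual ℂ V) :
    dualForm ha hb (∑ k ∈ s, c k • μ k) (∑ k ∈ s, d k • ν k) =
      ∑ k ∈ s, ∑ l ∈ s, c k * (conj (d l) * dualForm ha hb (μ k) (ν l)) := by
  simp only [map_sum, LinearMap.sum_apply, map_smul, LinearMap.smul_apply, LinearMap.map_smulₛₗ,
    smul_eq_mul, Finset.mul_sum]
  rw [Finset.sum_comm]
  exact Finset.sum_congr rfl fun k _ => Finset.sum_congr rfl fun l _ => by ring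

end DualForm

/-! ### The form of a tensor, and its two norming families -/

section SeriesForm

open scoped ComplexOrder ComplexConjugate

variable {H : Type u} [NormedAddCommGroup H] [InnerProductSpace ℂ H] [CompleteSpace H]
  {E : Type v} [TopologicalSpace E] {𝔄 : NonUnitalStarSubalgebra ℂ (H →L[ℂ] H)}

theorem ColConv.l2Bounded {ι : Type*} {b : ι → 𝔄} (hb : ColConv fun i => (b i : H →L[ℂ] H)) :
    L2Bounded b := by
  obtain ⟨C, hC0, hC⟩ := hb.bound
  refine ⟨C, hC0, fun t c => ?_⟩
  change ‖((∑ i ∈ t, c i • b i : 𝔄) : H →L[ℂ] H)‖ ≤ _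
  refine ContinuousLinearMap.opNorm_le_bound _ (by positivity) fun ζ => ?_
  rw [AddSubmonoidClass.coe_finsetSum, sum_apply]
  calc ‖∑ i ∈ t, ((c i • b i : 𝔄) : H →L[ℂ] H) ζ‖
      ≤ ∑ i ∈ t, ‖c i‖ * ‖(b i : H →L[ℂ] H) ζ‖ :=
        norm_sum_le_of_le _ fun i _ => by simp [norm_smul]
    _ ≤ Real.sqrt (∑ i ∈ t, ‖c i‖ ^ 2) * Real.sqrt (∑ i ∈ t, ‖(b i : H →L[ℂ] H) ζ‖ ^ 2) :=
        Real.sum_mul_le_sqrt_mul_sqrt _ _ _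
    _ ≤ Real.sqrt (∑ i ∈ t, ‖c i‖ ^ 2) * Real.sqrt (C * ‖ζ‖ ^ 2) := by
        gcongr
        exact hC ζ t
    _ = _ := by rw [Real.sqrt_mul hC0, Real.sqrt_sq (norm_nonneg _), mul_assoc]

theorem L2Bounded.star {ι : Type*} {b : ι → 𝔄} (hb : L2Bounded b) :
    L2Bounded fun i => star (b i) := by
  obtain ⟨C, hC0, hC⟩ := hb
  refine ⟨C, hC0, fun t c => ?_⟩
  have h1 : ∑ i ∈ t, c i • Star.star (b i) = Star.star (∑ i ∈ t, conj (c i) • b i) := by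
    simp [star_sum]
  have h2 := hC t fun i => conj (c i)
  simp only [RCLike.norm_conj] at h2
  rw [h1]
  change ‖Star.star ((∑ i ∈ t, conj (c i) • b i : 𝔄) : H →L[ℂ] H)‖ ≤ _
  rw [norm_star]
  exact h2

theorem RowConv.l2Bounded {ι : Type*} {b : ι → 𝔄} (hb : RowConv fun i => (b i : H →L[ℂ] H)) :
    L2Bounded b := by
  simpa using (ColConv.l2Bounded (b := fun i => Star.star (b i)) (by simpa using hb.colConv_star)).star

/-- The form on the dual of `𝔄` defined by a series `∑ i, v i ⊗ w i`. -/
noncomputable def Series.form (t : Series 𝔄 𝔄) :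
    StrongDual ℂ 𝔄 →ₗ[ℂ] StrongDual ℂ 𝔄 →ₗ⋆[ℂ] ℂ :=
  -- The adjoint on the right entries cancels the conjugation in the second variable: on
  -- `*`-preserving functionals the form is `∑ μ(v_i) ν(w_i)`.
  dualForm (RowConv.l2Bounded t.left_conv) (ColConv.l2Bounded t.right_conv).star

theorem Series.form_hasSum (t : Series 𝔄 𝔄) (μ ν : StrongDual ℂ 𝔄) :
    HasSum (fun i => μ (t.left i) * conj (ν (star (t.right i)))) (t.form μ ν) :=
  dualForm_hasSum _ _ μ ν

theorem Series.form_nonneg (h𝔄 : IsClosed (𝔄 : Set (H →L[ℂ] H))) (t : Series 𝔄 𝔄)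
    {P : Submodule ℂ (StrongDual ℂ 𝔄)} (hP : IsNorming P) (h : ∀ ν ∈ P, 0 ≤ t.form ν ν)
    (μ : StrongDual ℂ 𝔄) : 0 ≤ t.form μ μ := by
  have : CompleteSpace 𝔄 := h𝔄.completeSpace_coe
  exact hP.dualForm_nonneg _ _ h μ

/-- The functional `a ↦ ⟪ξ, a ζ⟫` on `𝔄`. -/
noncomputable def vectorFunctional (𝔄 : NonUnitalStarSubalgebra ℂ (H →L[ℂ] H)) (ξ ζ : H) :
    StrongDual ℂ 𝔄 :=
  LinearMap.mkContinuous
    { toFun := fun a => ⟪ξ, (a : H →L[ℂ] H) ζ⟫_ℂ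
      map_add' := fun a b => by simp
      map_smul' := fun c a => by simp }
    (‖ξ‖ * ‖ζ‖) fun a => by
      calc ‖⟪ξ, (a : H →L[ℂ] H) ζ⟫_ℂ‖ ≤ ‖ξ‖ * (‖(a : H →L[ℂ] H)‖ * ‖ζ‖) :=
            (norm_inner_le_norm _ _).trans (by gcongr; exact ContinuousLinearMap.le_opNorm _ _)
        _ = ‖ξ‖ * ‖ζ‖ * ‖a‖ := by
            change _ = ‖ξ‖ * ‖ζ‖ * ‖(a : H →L[ℂ] H)‖
            ring

theorem vectorFunctional_apply (ξ ζ : H) (a : 𝔄) :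
    vectorFunctional 𝔄 ξ ζ a = ⟪ξ, (a : H →L[ℂ] H) ζ⟫_ℂ := rfl

theorem norm_vectorFunctional_le (ξ ζ : H) : ‖vectorFunctional 𝔄 ξ ζ‖ ≤ ‖ξ‖ * ‖ζ‖ :=
  LinearMap.mkContinuous_norm_le _ (by positivity) _

/-- The functional `⟪d ζ, · ζ⟫` takes the value `‖d ζ‖²` at `d` and has norm at most `‖d ζ‖ ‖ζ‖`. -/
theorem isNorming_span_vectorFunctional : IsNorming (Submodule.span ℂ
    (Set.range fun p : H × H => vectorFunctional 𝔄 p.1 p.2)) := by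
  intro d c hc h
  change ‖(d : H →L[ℂ] H)‖ ≤ c
  refine ContinuousLinearMap.opNorm_le_bound _ hc fun ζ => ?_
  have h1 := h _ (Submodule.subset_span ⟨((d : H →L[ℂ] H) ζ, ζ), rfl⟩)
  simp only [vectorFunctional_apply, inner_self_eq_norm_sq_to_K] at h1
  rcases (norm_nonneg ((d : H →L[ℂ] H) ζ)).eq_or_lt with h0 | h0
  · rw [← h0]
    positivity
  refine le_of_mul_le_mul_left ?_ h0
  calc ‖(d : H →L[ℂ] H) ζ‖ * ‖(d : H →L[ℂ] H) ζ‖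
      ≤ c * ‖vectorFunctional 𝔄 ((d : H →L[ℂ] H) ζ) ζ‖ := by simpa [sq] using h1
    _ ≤ c * (‖(d : H →L[ℂ] H) ζ‖ * ‖ζ‖) := by gcongr; exact norm_vectorFunctional_le _ _
    _ = _ := by ring

theorem Series.form_vectorFunctional (t : Series 𝔄 𝔄) (ξ ζ ξ' ζ' : H) :
    t.form (vectorFunctional 𝔄 ξ ζ) (vectorFunctional 𝔄 ξ' ζ') =
      ⟪ξ, t.op (InnerProductSpace.rankOne ℂ ζ ζ') ξ'⟫_ℂ := by
  refine (t.form_hasSum _ _).unique ?_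
  refine ((t.op_spec (InnerProductSpace.rankOne ℂ ζ ζ')).inner ξ ξ').congr fun s =>
    Finset.sum_congr rfl fun i _ => ?_
  simp only
  rw [vectorFunctional_apply, vectorFunctional_apply, show ((star (t.right i) : 𝔄) : H →L[ℂ] H) = star (t.right i : H →L[ℂ] H) from rfl,
    inner_conj_symm, ContinuousLinearMap.star_eq_adjoint, ContinuousLinearMap.adjoint_inner_left]
  simp [mul_comm]

/-- Evaluation of the transform at a point. -/
noncomputable def evalFunctional (h𝔄 : IsClosed (𝔄 : Set (H →L[ℂ] H)))
    (F : 𝔄 →⋆ₙₐ[ℂ] BoundedContinuousFunction E ℂ) (x : E) : StrongDual ℂ 𝔄 :=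
  LinearMap.mkContinuous
    { toFun := fun a => F a x
      map_add' := fun a b => by simp
      map_smul' := fun c a => by simp [map_smul] }
    1 fun a => by
      have : IsClosed (𝔄 : Set (H →L[ℂ] H)) := h𝔄
      rw [one_mul]
      exact (BoundedContinuousFunction.norm_coe_le_norm _ _).trans
        (NonUnitalStarAlgHom.norm_apply_le F _)

theorem isNorming_span_evalFunctional (h𝔄 : IsClosed (𝔄 : Set (H →L[ℂ] H)))
    {F : 𝔄 →⋆ₙₐ[ℂ] BoundedContinuousFunction E ℂ} (hF : Function.Injective F) :
    IsNorming (Submodule.span ℂ (Set.range (evalFunctional h𝔄 F))) := by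
  have : IsClosed (𝔄 : Set (H →L[ℂ] H)) := h𝔄
  intro d c hc h
  rw [← NonUnitalStarAlgHom.norm_map F hF d, BoundedContinuousFunction.norm_le hc]
  intro x
  refine (h _ (Submodule.subset_span ⟨x, rfl⟩)).trans ?_
  exact mul_le_of_le_one_right hc (LinearMap.mkContinuous_norm_le _ zero_le_one _)

theorem Series.form_evalFunctional (h𝔄 : IsClosed (𝔄 : Set (H →L[ℂ] H)))
    (F : 𝔄 →⋆ₙₐ[ℂ] BoundedContinuousFunction E ℂ) (t : Series 𝔄 𝔄) (x y : E) :
    HasSum (fun i => F (t.left i) x * F (t.right i) y)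
      (t.form (evalFunctional h𝔄 F x) (evalFunctional h𝔄 F y)) := by
  refine (t.form_hasSum _ _).congr fun s => Finset.sum_congr rfl fun i _ => ?_
  change F (t.left i) x * conj (F (star (t.right i)) y) = _
  rw [map_star, BoundedContinuousFunction.star_apply]
  simp

theorem Series.eval_eq_form (h𝔄 : IsClosed (𝔄 : Set (H →L[ℂ] H)))
    (F : 𝔄 →⋆ₙₐ[ℂ] BoundedContinuousFunction E ℂ) (t : Series 𝔄 𝔄) (x y : E) :
    t.eval F x y = t.form (evalFunctional h𝔄 F x) (evalFunctional h𝔄 F y) :=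
  (t.form_evalFunctional h𝔄 F x y).tsum_eq

end SeriesForm

/-! ### Cyclic subspaces of the commutant and bimodule maps -/

section Commutant

open scoped ComplexOrder ComplexConjugate

set_option linter.unusedSectionVars false

variable {H : Type u} [NormedAddCommGroup H] [InnerProductSpace ℂ H] [CompleteSpace H]

/-- The closed subspace generated by `ξ` under the algebra `M`. -/
noncomputable def cyclicSubspace (M : StarSubalgebra ℂ (H →L[ℂ] H)) (ξ : H) : Submodule ℂ H :=
  (M.toSubalgebra.toSubmodule.map (ContinuousLinearMap.apply ℂ H ξ).toLinearMap).topologicalClosure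

variable {M : StarSubalgebra ℂ (H →L[ℂ] H)}

theorem apply_mem_cyclicSubspace {a : H →L[ℂ] H} (ha : a ∈ M) (ξ : H) :
    a ξ ∈ cyclicSubspace M ξ :=
  Submodule.le_topologicalClosure _ ⟨a, ha, rfl⟩

theorem self_mem_cyclicSubspace (ξ : H) : ξ ∈ cyclicSubspace M ξ :=
  apply_mem_cyclicSubspace (one_mem M) ξ

theorem map_mem_cyclicSubspace {a : H →L[ℂ] H} (ha : a ∈ M) {ξ η : H}
    (hη : η ∈ cyclicSubspace M ξ) : a η ∈ cyclicSubspace M ξ := by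
  refine map_mem_closure a.continuous hη ?_
  rintro _ ⟨b, hb, rfl⟩
  exact ⟨a * b, M.mul_mem ha hb, rfl⟩

theorem cyclicSubspace_le {ξ ζ : H} (h : ξ ∈ cyclicSubspace M ζ) :
    cyclicSubspace M ξ ≤ cyclicSubspace M ζ := by
  refine Submodule.topologicalClosure_minimal _ ?_ (Submodule.isClosed_topologicalClosure _)
  rintro _ ⟨b, hb, rfl⟩
  exact map_mem_cyclicSubspace hb h

instance (ξ : H) : CompleteSpace (cyclicSubspace M ξ) :=
  (Submodule.isClosed_topologicalClosure _).completeSpace_coe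

/-- The subspace is invariant under both `b` and its adjoint, hence reducing. -/
theorem starProjection_cyclicSubspace_commute {b : H →L[ℂ] H} (hb : b ∈ M) (ξ : H) :
    (cyclicSubspace M ξ).starProjection * b = b * (cyclicSubspace M ξ).starProjection := by
  set e := (cyclicSubspace M ξ).starProjection with he
  have h1 : ∀ c ∈ M, e * c * e = c * e := by
    intro c hc
    ext η
    exact Submodule.starProjection_eq_self_iff.mpr
      (map_mem_cyclicSubspace hc (Submodule.starProjection_apply_mem _ η))
  have hes : star e = e := isSelfAdjoint_starProjection _
  have h2 := congrArg star (h1 (star b) (star_mem hb))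
  rw [star_mul, star_mul, star_mul, star_star, hes] at h2
  rw [← h2, ← mul_assoc, h1 b hb]

/-- If `M` contains its commutant, then any two vectors lie in a common cyclic subspace. -/
theorem exists_cyclic_pair (hM : ∀ e : H →L[ℂ] H, (∀ b ∈ M, e * b = b * e) → e ∈ M) (ξ η : H) :
    ∃ ζ, ξ ∈ cyclicSubspace M ζ ∧ η ∈ cyclicSubspace M ζ := by
  set e := (cyclicSubspace M ξ).starProjection with he
  have heM : e ∈ M := hM e fun b hb => starProjection_cyclicSubspace_commute hb ξ
  have hee : e (e η) = e η :=
    Submodule.starProjection_eq_self_iff.mpr (Submodule.starProjection_apply_mem _ η)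
  have heξ : e ξ = ξ := Submodule.starProjection_eq_self_iff.mpr (self_mem_cyclicSubspace ξ)
  -- The projection `e ∈ M` recovers `ξ` from `ζ`. The remainder `ζ - ξ` and `e η`, which lies in
  -- the cyclic subspace of `ξ`, then recover `η`.
  set ζ := ξ + (η - e η) with hζ
  have h1 : e ζ = ξ := by rw [hζ, map_add, map_sub, hee, heξ, sub_self, add_zero]
  have hξ : ξ ∈ cyclicSubspace M ζ := by
    have := apply_mem_cyclicSubspace heM ζ
    rwa [h1] at this
  refine ⟨ζ, hξ, ?_⟩
  have h2 : η = e η + (ζ - ξ) := by rw [hζ]; abel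
  rw [h2]
  exact Submodule.add_mem _ (cyclicSubspace_le hξ (Submodule.starProjection_apply_mem _ η))
    (Submodule.sub_mem _ (self_mem_cyclicSubspace ζ) hξ)

theorem exists_cyclic (hM : ∀ e : H →L[ℂ] H, (∀ b ∈ M, e * b = b * e) → e ∈ M) :
    ∀ (n : ℕ) (ξ : Fin n → H), ∃ ζ, ∀ p, ξ p ∈ cyclicSubspace M ζ
  | 0, _ => ⟨0, fun p => p.elim0⟩
  | n + 1, ξ => by
    obtain ⟨ζ, hζ⟩ := exists_cyclic hM n fun p => ξ p.succ
    obtain ⟨ζ', h1, h2⟩ := exists_cyclic_pair hM (ξ 0) ζ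
    exact ⟨ζ', Fin.cases h1 fun p => cyclicSubspace_le h2 (hζ p)⟩

theorem inner_apply_nonneg {A : H →L[ℂ] H} (hA : 0 ≤ A) (ξ : H) : 0 ≤ ⟪ξ, A ξ⟫_ℂ :=
  ((ContinuousLinearMap.nonneg_iff_isPositive A).mp hA).inner_nonneg_right ξ

theorem nonneg_of_inner_apply_nonneg {A : H →L[ℂ] H} (hA : ∀ ξ, 0 ≤ ⟪ξ, A ξ⟫_ℂ) : 0 ≤ A := by
  rw [ContinuousLinearMap.nonneg_iff_isPositive, ContinuousLinearMap.isPositive_iff_complex]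
  intro ξ
  have h := Complex.nonneg_iff.mp (hA ξ)
  rw [← inner_conj_symm, RCLike.re_to_complex, Complex.conj_re]
  refine ⟨Complex.ext (by rw [Complex.ofReal_re, Complex.conj_re]) ?_, h.1⟩
  rw [Complex.ofReal_im, Complex.conj_im, ← h.2, neg_zero]

/-- A positive map which is a bimodule map over `M` satisfies the matrix form of positivity, when
`M` contains its commutant. -/
theorem IsPositiveMap.sum_inner_nonneg {L : (H →L[ℂ] H) →ₗ[ℂ] (H →L[ℂ] H)}
    (hL : IsPositiveMap L) (hM : ∀ e : H →L[ℂ] H, (∀ b ∈ M, e * b = b * e) → e ∈ M)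
    (hbi : ∀ a ∈ M, ∀ b ∈ M, ∀ x, L (a * x * b) = a * L x * b) {n : ℕ}
    (X : Fin n → Fin n → H →L[ℂ] H)
    (hX : ∀ a : Fin n → H →L[ℂ] H, 0 ≤ ∑ p, ∑ q, star (a p) * X p q * a q) (ξ : Fin n → H) :
    0 ≤ ∑ p, ∑ q, ⟪ξ p, L (X p q) (ξ q)⟫_ℂ := by
  obtain ⟨ζ, hζ⟩ := exists_cyclic hM n ξ
  have hcl : IsClosed {η : Fin n → H | 0 ≤ ∑ p, ∑ q, ⟪η p, L (X p q) (η q)⟫_ℂ} :=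
    isClosed_le continuous_const (by fun_prop)
  have hmem : ξ ∈ closure (Set.univ.pi fun _ : Fin n =>
      ((M.toSubalgebra.toSubmodule.map (ContinuousLinearMap.apply ℂ H ζ).toLinearMap :
        Submodule ℂ H) : Set H)) := by
    rw [closure_pi_set]
    exact fun p _ => hζ p
  refine closure_minimal ?_ hcl hmem
  intro η hη
  choose a haM ha using fun p => hη p trivial
  -- For the dense set of tuples `η p = a p ζ`, the bimodule property moves the `a p` inside `L` and
  -- leaves one positive operator tested at `ζ`.
  have h1 : ∑ p, ∑ q, ⟪η p, L (X p q) (η q)⟫_ℂ =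
      ⟪ζ, L (∑ p, ∑ q, star (a p) * X p q * a q) ζ⟫_ℂ := by
    simp only [map_sum, sum_apply, inner_sum]
    refine Finset.sum_congr rfl fun p _ => Finset.sum_congr rfl fun q _ => ?_
    rw [hbi _ (star_mem (haM p)) _ (haM q), ← ha, ← ha, mul_assoc,
      ContinuousLinearMap.star_eq_adjoint, mul_apply_eq_comp,
      ContinuousLinearMap.adjoint_inner_right]
    rfl
  refine le_of_le_of_eq ?_ h1.symm
  exact inner_apply_nonneg (hL _ (hX a)) ζ

variable {𝔄 : NonUnitalStarSubalgebra ℂ (H →L[ℂ] H)}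

/-- The commutant of `𝔄`. -/
noncomputable def commutant (𝔄 : NonUnitalStarSubalgebra ℂ (H →L[ℂ] H)) :
    StarSubalgebra ℂ (H →L[ℂ] H) :=
  StarSubalgebra.centralizer ℂ (𝔄 : Set (H →L[ℂ] H))

theorem mem_commutant {a : H →L[ℂ] H} : a ∈ commutant 𝔄 ↔ ∀ b ∈ 𝔄, b * a = a * b := by
  rw [commutant, StarSubalgebra.mem_centralizer_iff]
  refine ⟨fun h b hb => (h b hb).1, fun h b hb => ⟨h b hb, h _ (star_mem hb)⟩⟩

theorem Series.op_bimodule (t : Series 𝔄 𝔄) {a b : H →L[ℂ] H} (ha : a ∈ commutant 𝔄)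
    (hb : b ∈ commutant 𝔄) (x : H →L[ℂ] H) : t.op (a * x * b) = a * t.op x * b := by
  ext ξ
  refine ext_inner_left ℂ fun η => ((t.op_spec (a * x * b)).inner η ξ).unique ?_
  have h1 := (t.op_spec x).inner (star a η) (b ξ)
  rw [ContinuousLinearMap.star_eq_adjoint] at h1
  simp only [ContinuousLinearMap.adjoint_inner_left] at h1
  refine h1.congr fun s => Finset.sum_congr rfl fun i _ => ?_
  have h2 := mem_commutant.mp ha _ (t.left i).2
  have h3 := mem_commutant.mp hb _ (t.right i).2
  have h4 : (t.left i : H →L[ℂ] H) * (a * x * b) * (t.right i : H →L[ℂ] H) =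
      a * ((t.left i : H →L[ℂ] H) * x * (t.right i : H →L[ℂ] H)) * b := by
    simp only [mul_assoc]
    rw [h3, ← mul_assoc, h2, mul_assoc]
  simp only [h4]
  rfl

/-- Positivity of the operator of a series over an abelian algebra in matrix form. -/
theorem Series.sum_inner_nonneg (hcomm : ∀ a ∈ 𝔄, ∀ b ∈ 𝔄, a * b = b * a) (t : Series 𝔄 𝔄)
    (ht : IsPositiveMap t.op) {n : ℕ} (X : Fin n → Fin n → H →L[ℂ] H)
    (hX : ∀ a : Fin n → H →L[ℂ] H, 0 ≤ ∑ p, ∑ q, star (a p) * X p q * a q) (ξ : Fin n → H) :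
    0 ≤ ∑ p, ∑ q, ⟪ξ p, t.op (X p q) (ξ q)⟫_ℂ := by
  refine ht.sum_inner_nonneg (M := commutant 𝔄) (fun e he => ?_)
    (fun a ha b hb x => t.op_bimodule ha hb x) X hX ξ
  -- Commutativity puts `𝔄` inside `𝔄'`, so whatever commutes with `𝔄'` commutes with `𝔄`.
  refine mem_commutant.mpr fun b hb => (he b ?_).symm
  exact mem_commutant.mpr fun c hc => hcomm c hc b hb

end Commutant

/-! ### Positivity of operator matrices through quadratic forms -/

section MatrixPositivity

open scoped ComplexOrder ComplexConjugate

set_option linter.unusedSectionVars false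

variable {H : Type u} [NormedAddCommGroup H] [InnerProductSpace ℂ H] [CompleteSpace H] {n : ℕ}

theorem exists_eq_star_mul_self {A : Type*} [CStarAlgebra A] [PartialOrder A] [StarOrderedRing A]
    {X : A} (hX : 0 ≤ X) : ∃ Y, X = star Y * Y :=
  CStarAlgebra.nonneg_iff_eq_star_mul_self.mp hX

/-- The negative part of a self-adjoint element compresses it to a nonpositive element. -/
theorem exists_neg_compression {A : Type*} [CStarAlgebra A] [PartialOrder A] [StarOrderedRing A]
    {X : A} (hX : IsSelfAdjoint X) :
    ∃ N Y : A, star N = N ∧ N = star Y * Y ∧ N * X * N = -(N * N * N) ∧ (N = 0 → 0 ≤ X) := by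
  obtain ⟨Y, hY⟩ := CStarAlgebra.nonneg_iff_eq_star_mul_self.mp (CFC.negPart_nonneg X)
  refine ⟨X⁻, Y, (IsSelfAdjoint.of_nonneg (CFC.negPart_nonneg X)), hY, ?_, fun h => ?_⟩
  · conv_lhs => enter [1, 2]; rw [← CFC.posPart_sub_negPart X hX]
    rw [mul_sub, CFC.negPart_mul_posPart, zero_sub, neg_mul]
  · rw [← CFC.posPart_sub_negPart X hX, h, sub_zero]
    exact CFC.posPart_nonneg X

theorem sum_star_mul_mul_nonneg {X : CStarMatrix (Fin n) (Fin n) (H →L[ℂ] H)} (hX : 0 ≤ X)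
    (a : Fin n → H →L[ℂ] H) : 0 ≤ ∑ p, ∑ q, star (a p) * X p q * a q := by
  obtain ⟨Y, rfl⟩ := exists_eq_star_mul_self hX
  have h : ∑ p, ∑ q, star (a p) * (star Y * Y) p q * a q =
      ∑ r, star (∑ p, Y r p * a p) * ∑ q, Y r q * a q := by
    simp only [star_sum, Finset.sum_mul_sum]
    rw [Finset.sum_comm (s := Finset.univ) (t := Finset.univ)
      (f := fun r p => ∑ q, star (Y r p * a p) * (Y r q * a q))]
    refine Finset.sum_congr rfl fun p _ => ?_
    rw [Finset.sum_comm]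
    refine Finset.sum_congr rfl fun q _ => ?_
    rw [CStarMatrix.mul_apply, Finset.mul_sum, Finset.sum_mul]
    refine Finset.sum_congr rfl fun r _ => ?_
    rw [CStarMatrix.star_apply, star_mul]
    simp only [mul_assoc]
  rw [h]
  exact Finset.sum_nonneg fun r _ => star_mul_self_nonneg _

/-- The quadratic form of an operator matrix. -/
noncomputable def matrixForm (X : CStarMatrix (Fin n) (Fin n) (H →L[ℂ] H)) (ξ η : Fin n → H) : ℂ :=
  ∑ p, ∑ q, ⟪ξ p, X p q (η q)⟫_ℂ

/-- The action of an operator matrix on a tuple of vectors. -/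
noncomputable def matrixAct (X : CStarMatrix (Fin n) (Fin n) (H →L[ℂ] H)) (ξ : Fin n → H) :
    Fin n → H :=
  fun p => ∑ q, X p q (ξ q)

theorem matrixForm_eq (X : CStarMatrix (Fin n) (Fin n) (H →L[ℂ] H)) (ξ η : Fin n → H) :
    matrixForm X ξ η = ∑ p, ⟪ξ p, matrixAct X η p⟫_ℂ := by
  simp [matrixForm, matrixAct]

theorem matrixAct_mul (X Y : CStarMatrix (Fin n) (Fin n) (H →L[ℂ] H)) (ξ : Fin n → H) :
    matrixAct (X * Y) ξ = matrixAct X (matrixAct Y ξ) := by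
  funext p
  simp only [matrixAct, CStarMatrix.mul_apply, sum_apply, map_sum]
  rw [Finset.sum_comm]
  rfl

theorem matrixForm_mul (X Y : CStarMatrix (Fin n) (Fin n) (H →L[ℂ] H)) (ξ η : Fin n → H) :
    matrixForm (X * Y) ξ η = matrixForm X ξ (matrixAct Y η) := by
  rw [matrixForm_eq, matrixForm_eq, matrixAct_mul]

theorem matrixForm_star_mul (X Y : CStarMatrix (Fin n) (Fin n) (H →L[ℂ] H)) (ξ η : Fin n → H) :
    matrixForm (star X * Y) ξ η = matrixForm Y (matrixAct X ξ) η := by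
  rw [matrixForm_mul]
  rw [matrixForm_eq Y]
  simp only [matrixForm]
  rw [Finset.sum_comm]
  refine Finset.sum_congr rfl fun p _ => ?_
  rw [show matrixAct X ξ p = ∑ q, X p q (ξ q) from rfl, sum_inner]
  refine Finset.sum_congr rfl fun q _ => ?_
  rw [CStarMatrix.star_apply, ContinuousLinearMap.star_eq_adjoint,
    ContinuousLinearMap.adjoint_inner_right]

theorem eq_zero_of_matrixForm_star_mul_self {Y : CStarMatrix (Fin n) (Fin n) (H →L[ℂ] H)}
    (h : ∀ ξ, (matrixForm (star Y * Y) ξ ξ).re ≤ 0) : Y = 0 := by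
  have h0 : ∀ ξ, matrixAct Y ξ = 0 := by
    intro ξ
    have h1 := h ξ
    rw [matrixForm_star_mul, matrixForm_eq, Complex.re_sum] at h1
    have h2 : ∀ p ∈ Finset.univ, 0 ≤ (⟪matrixAct Y ξ p, matrixAct Y ξ p⟫_ℂ).re :=
      fun p _ => inner_self_nonneg (𝕜 := ℂ)
    have h3 := (Finset.sum_eq_zero_iff_of_nonneg h2).mp (le_antisymm h1 (Finset.sum_nonneg h2))
    funext p
    have h4 := h3 p (Finset.mem_univ p)
    exact (re_inner_self_nonpos (𝕜 := ℂ)).mp h4.le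
  ext p q ζ
  have := congrFun (h0 (Pi.single q ζ)) p
  rw [matrixAct, Finset.sum_eq_single q] at this
  · simpa using this
  · intro r _ hr
    simp [Pi.single_eq_of_ne hr]
  · simp

/-- A self-adjoint operator matrix with nonnegative quadratic form is nonnegative. -/
theorem nonneg_of_matrixForm_nonneg {X : CStarMatrix (Fin n) (Fin n) (H →L[ℂ] H)}
    (hX : IsSelfAdjoint X) (h : ∀ ξ, 0 ≤ (matrixForm X ξ ξ).re) : 0 ≤ X := by
  obtain ⟨N, Y, hNs, hY, h1, hpos⟩ := exists_neg_compression hX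
  -- With `N = Y*Y` the negative part, `(YN)*(YN) = N³ = -NXN` has a nonpositive quadratic form, so
  -- `YN` vanishes.
  have hYN : Y * N = 0 := by
    refine eq_zero_of_matrixForm_star_mul_self fun ξ => ?_
    have h2 : star (Y * N) * (Y * N) = -(star N * (X * N)) := by
      rw [star_mul, hNs, ← mul_assoc N X, h1, neg_neg, mul_assoc, ← mul_assoc (star Y), ← hY,
        mul_assoc]
    have h3 : matrixForm (-(star N * (X * N))) ξ ξ = -matrixForm (star N * (X * N)) ξ ξ := by
      simp [matrixForm]
    rw [h2, h3, matrixForm_star_mul, matrixForm_mul, Complex.neg_re]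
    linarith [h (matrixAct N ξ)]
  have hNN : star N * N = 0 := by
    rw [hNs]
    nth_rewrite 1 [hY]
    rw [mul_assoc, hYN, mul_zero]
  exact hpos ((CStarRing.star_mul_self_eq_zero_iff N).mp hNN)

/-- Positivity of `L` is used only to preserve adjoints, which makes the image matrix self-adjoint.
-/
theorem isCompletelyPositiveMap_of_sum_inner_nonneg {L : (H →L[ℂ] H) →ₗ[ℂ] (H →L[ℂ] H)}
    (hL : IsPositiveMap L)
    (h : ∀ (n : ℕ) (X : Fin n → Fin n → H →L[ℂ] H),
      (∀ a : Fin n → H →L[ℂ] H, 0 ≤ ∑ p, ∑ q, star (a p) * X p q * a q) →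
      ∀ ξ : Fin n → H, 0 ≤ ∑ p, ∑ q, ⟪ξ p, L (X p q) (ξ q)⟫_ℂ) :
    IsCompletelyPositiveMap L := by
  refine ⟨⟨L, fun k M hM => nonneg_of_matrixForm_nonneg ?_ fun ξ =>
    (Complex.nonneg_iff.mp (h k (fun p q => M p q) (sum_star_mul_mul_nonneg hM) ξ)).1⟩, rfl⟩
  have hs := IsSelfAdjoint.of_nonneg hM
  ext1 p q
  rw [CStarMatrix.star_apply, CStarMatrix.map_apply, CStarMatrix.map_apply]
  have h1 : M p q = star (M q p) := (CStarMatrix.star_apply_of_isSelfAdjoint hs).symm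
  rw [h1]
  exact (map_star (PositiveLinearMap.mk₀ L hL) (M q p)).symm

end MatrixPositivity

/-! ### The equivalences -/

section Main

open scoped ComplexOrder ComplexConjugate

variable {H : Type u} [NormedAddCommGroup H] [InnerProductSpace ℂ H] [CompleteSpace H]
  {E : Type v} [TopologicalSpace E] {𝔄 : NonUnitalStarSubalgebra ℂ (H →L[ℂ] H)}

theorem Series.eval_mem_tensorFunctions (h𝔄 : IsClosed (𝔄 : Set (H →L[ℂ] H)))
    (F : 𝔄 →⋆ₙₐ[ℂ] BoundedContinuousFunction E ℂ) (t : Series 𝔄 𝔄) :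
    t.eval F ∈ tensorFunctions.{u, v} (Set.range F) :=
  ⟨t.ι, fun i => F (t.left i), fun i => F (t.right i), fun i => ⟨_, rfl⟩, fun i => ⟨_, rfl⟩,
    RowConv.summable_eval h𝔄 F t.left_conv, ColConv.summable_eval h𝔄 F t.right_conv,
    fun x y => by
      rw [t.eval_eq_form h𝔄]
      exact t.form_evalFunctional h𝔄 F x y⟩

/-- A positive series over an abelian algebra has a nonnegative form. -/
theorem Series.form_nonneg_of_isPositiveMap (h𝔄 : IsClosed (𝔄 : Set (H →L[ℂ] H)))
    (hcomm : ∀ a ∈ 𝔄, ∀ b ∈ 𝔄, a * b = b * a) (t : Series 𝔄 𝔄) (ht : IsPositiveMap t.op)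
    (μ : StrongDual ℂ 𝔄) : 0 ≤ t.form μ μ := by
  refine t.form_nonneg h𝔄 isNorming_span_vectorFunctional (fun ν hν => ?_) μ
  obtain ⟨n, c, g, rfl⟩ := Submodule.mem_span_set'.mp hν
  choose p hp using fun k => (g k).2
  obtain ⟨ζ, hζ⟩ : ∃ ζ : Fin n → H,
      ∀ k, c k • (g k : StrongDual ℂ 𝔄) = vectorFunctional 𝔄 (p k).1 (ζ k) := by
    refine ⟨fun k => c k • (p k).2, fun k => ?_⟩
    rw [← hp]
    ext a
    simp [vectorFunctional_apply]
  simp only [hζ, map_sum, LinearMap.sum_apply, form_vectorFunctional]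
  rw [Finset.sum_comm]
  refine t.sum_inner_nonneg hcomm ht
    (fun k l => InnerProductSpace.rankOne ℂ (ζ k) (ζ l)) (fun a => ?_)
    fun k => (p k).1
  -- The matrix of rank one operators `ζ_k ⊗ ζ_l*` compresses to the rank one operator of the single
  -- vector `∑ a_k* ζ_k`.
  have h1 : ∑ k, ∑ l, star (a k) *
      InnerProductSpace.rankOne ℂ (ζ k) (ζ l) * a l =
      InnerProductSpace.rankOne ℂ (∑ k, star (a k) (ζ k))
        (∑ k, star (a k) (ζ k)) := by
    ext ξ
    simp only [sum_apply, InnerProductSpace.rankOne_apply, sum_inner, Finset.sum_smul,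
      Finset.smul_sum, mul_apply_eq_comp, ContinuousLinearMap.star_eq_adjoint,
      ContinuousLinearMap.adjoint_inner_left, map_smul]
  rw [h1]
  refine nonneg_of_inner_apply_nonneg fun ξ => ?_
  rw [InnerProductSpace.rankOne_apply, inner_smul_right, mul_comm, ← inner_conj_symm ξ,
    Complex.conj_mul', ← Complex.ofReal_pow]
  exact Complex.zero_le_real.mpr (sq_nonneg _)

/-- Positivity of the operator of a series needs to be checked on rank one operators only. -/
theorem Series.isPositiveMap_of_rankOne (t : Series 𝔄 𝔄)
    (h : ∀ ξ ζ : H, 0 ≤ ⟪ξ, t.op (InnerProductSpace.rankOne ℂ ζ ζ) ξ⟫_ℂ) :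
    IsPositiveMap t.op := by
  intro y hy
  obtain ⟨z, rfl⟩ := exists_eq_star_mul_self hy
  refine nonneg_of_inner_apply_nonneg fun ξ => ?_
  obtain ⟨w, e, -⟩ := exists_hilbertBasis ℂ H
  have hsq : ∀ {b : t.ι → H →L[ℂ] H}, ColConv b →
      Summable fun q : t.ι × w => ‖⟪e q.2, z (b q.1 ξ)⟫_ℂ‖ ^ 2 := by
    intro b hb
    obtain ⟨C, hC0, hC⟩ := hb.bound
    have hfib : ∀ i, HasSum (fun k => ‖⟪e k, z (b i ξ)⟫_ℂ‖ ^ 2) (‖z (b i ξ)‖ ^ 2) := by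
      intro i
      have := Complex.hasSum_re (e.hasSum_inner_mul_inner (z (b i ξ)) (z (b i ξ)))
      rw [inner_self_eq_norm_sq_to_K] at this
      convert! this using 1
      · funext k
        rw [← inner_conj_symm (z (b i ξ)), Complex.conj_mul']
        norm_cast
      · norm_cast
    rw [summable_prod_of_nonneg (fun _ => by positivity)]
    refine ⟨fun i => (hfib i).summable, ?_⟩
    simp only [(hfib _).tsum_eq]
    refine Summable.of_nonneg_of_le (fun _ => by positivity) (fun i => ?_)
      ((summable_of_sum_le (fun _ => by positivity) (hC ξ)).mul_left (‖z‖ ^ 2))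
    rw [← mul_pow]
    exact pow_le_pow_left₀ (norm_nonneg _) (z.le_opNorm _) 2
  -- The double family over series index and basis index is absolutely summable. Summing over the
  -- basis first yields the terms of `T(z*z)`; summing over the series first yields `T` at the rank
  -- one operators of `z* e_k`.
  have hsum := summable_mul_conj (hsq t.right_conv) (hsq t.left_conv.colConv_star)
  have hrow : ∀ i, HasSum
      (fun k => ⟪e k, z ((t.right i : H →L[ℂ] H) ξ)⟫_ℂ *
        conj ⟪e k, z (star (t.left i : H →L[ℂ] H) ξ)⟫_ℂ)
      ⟪ξ, ((t.left i : H →L[ℂ] H) * (star z * z) * (t.right i : H →L[ℂ] H)) ξ⟫_ℂ := by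
    intro i
    have h1 := e.hasSum_inner_mul_inner (z (star (t.left i : H →L[ℂ] H) ξ))
      (z ((t.right i : H →L[ℂ] H) ξ))
    have h2 : ⟪ξ, ((t.left i : H →L[ℂ] H) * (star z * z) * (t.right i : H →L[ℂ] H)) ξ⟫_ℂ =
        ⟪z (star (t.left i : H →L[ℂ] H) ξ), z ((t.right i : H →L[ℂ] H) ξ)⟫_ℂ := by
      rw [← ContinuousLinearMap.adjoint_inner_right z, ContinuousLinearMap.star_eq_adjoint,
        ContinuousLinearMap.star_eq_adjoint, ContinuousLinearMap.adjoint_inner_left]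
      rfl
    rw [h2]
    refine h1.congr fun s => Finset.sum_congr rfl fun k _ => ?_
    simp only [inner_conj_symm]
    ring
  have hcol : ∀ k, HasSum
      (fun i => ⟪e k, z ((t.right i : H →L[ℂ] H) ξ)⟫_ℂ *
        conj ⟪e k, z (star (t.left i : H →L[ℂ] H) ξ)⟫_ℂ)
      ⟪ξ, t.op (InnerProductSpace.rankOne ℂ (star z (e k)) (star z (e k))) ξ⟫_ℂ := by
    intro k
    refine ((t.op_spec _).inner ξ ξ).congr fun s => Finset.sum_congr rfl fun i _ => ?_
    simp only [mul_apply_eq_comp, InnerProductSpace.rankOne_apply, map_smul, inner_smul_right,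
      ContinuousLinearMap.star_eq_adjoint, ContinuousLinearMap.adjoint_inner_left, inner_conj_symm]
    rw [← ContinuousLinearMap.adjoint_inner_right z, ContinuousLinearMap.adjoint_inner_left]
  have h1 := (hsum.hasSum.prod_fiberwise hrow).unique ((t.op_spec (star z * z)).inner ξ ξ)
  have h2 := ((Equiv.prodComm w t.ι).hasSum_iff.mpr hsum.hasSum).prod_fiberwise hcol
  rw [← h1]
  exact h2.nonneg fun k => h ξ _

theorem Series.isPositiveMap_of_form_nonneg (t : Series 𝔄 𝔄) (h : ∀ μ, 0 ≤ t.form μ μ) :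
    IsPositiveMap t.op :=
  t.isPositiveMap_of_rankOne fun ξ ζ => by
    rw [← t.form_vectorFunctional]
    exact h _

/-- The coefficients are conjugated because the form is linear in its first variable, while the
matrix form is conjugate linear there. -/
theorem Series.form_evalFunctional_sum (h𝔄 : IsClosed (𝔄 : Set (H →L[ℂ] H)))
    (F : 𝔄 →⋆ₙₐ[ℂ] BoundedContinuousFunction E ℂ) (t : Series 𝔄 𝔄) {n : ℕ} (x : Fin n → E)
    (c : Fin n → ℂ) :
    t.form (∑ k, star (c k) • evalFunctional h𝔄 F (x k))
      (∑ k, star (c k) • evalFunctional h𝔄 F (x k)) =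
      star c ⬝ᵥ ((Matrix.of fun i j => t.eval F (x i) (x j)).mulVec c) := by
  rw [Series.form, dualForm_sum_smul]
  simp only [dotProduct, Matrix.mulVec, Finset.mul_sum, Matrix.of_apply, t.eval_eq_form h𝔄,
    Pi.star_apply]
  refine Finset.sum_congr rfl fun k _ => Finset.sum_congr rfl fun l _ => ?_
  rw [Complex.star_def, Complex.conj_conj, Series.form]
  ring

theorem Series.form_nonneg_of_isPositiveDefinite (h𝔄 : IsClosed (𝔄 : Set (H →L[ℂ] H)))
    {F : 𝔄 →⋆ₙₐ[ℂ] BoundedContinuousFunction E ℂ} (hF : Function.Injective F) (t : Series 𝔄 𝔄)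
    (h : IsPositiveDefinite (t.eval F)) (μ : StrongDual ℂ 𝔄) : 0 ≤ t.form μ μ := by
  refine t.form_nonneg h𝔄 (isNorming_span_evalFunctional h𝔄 hF) (fun ν hν => ?_) μ
  obtain ⟨n, c, g, rfl⟩ := Submodule.mem_span_set'.mp hν
  choose x hx using fun k => (g k).2
  simp only [← hx]
  have h1 := t.form_evalFunctional_sum h𝔄 F x fun k => star (c k)
  simp only [star_star] at h1
  rw [h1]
  exact (h n x).dotProduct_mulVec_nonneg _

theorem Series.isPositiveDefinite_of_form_nonneg (h𝔄 : IsClosed (𝔄 : Set (H →L[ℂ] H)))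
    (F : 𝔄 →⋆ₙₐ[ℂ] BoundedContinuousFunction E ℂ) (t : Series 𝔄 𝔄) (h : ∀ μ, 0 ≤ t.form μ μ) :
    IsPositiveDefinite (t.eval F) := by
  intro n x
  refine Matrix.PosSemidef.of_dotProduct_mulVec_nonneg ?_ fun c => ?_
  · ext i j
    rw [Matrix.conjTranspose_apply, Matrix.of_apply, Matrix.of_apply, t.eval_eq_form h𝔄,
      t.eval_eq_form h𝔄]
    exact conj_apply_of_nonneg (P := ⊤) (fun ν _ => h ν) trivial trivial
  · rw [← t.form_evalFunctional_sum h𝔄]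
    exact h _

theorem IsCompletelyPositiveMap.isPositiveMap {L : (H →L[ℂ] H) →ₗ[ℂ] (H →L[ℂ] H)}
    (hL : IsCompletelyPositiveMap L) : IsPositiveMap L := by
  obtain ⟨Φ, rfl⟩ := hL
  exact fun a ha => map_nonneg Φ ha

end Main
end ExtHaagerup

theorem theorem2p4 {H : Type u} [NormedAddCommGroup H] [InnerProductSpace ℂ H] [CompleteSpace H]
    (𝔄 : NonUnitalStarSubalgebra ℂ (H →L[ℂ] H)) (h𝔄 : IsClosed (𝔄 : Set (H →L[ℂ] H)))
    (hcomm : ∀ a ∈ 𝔄, ∀ b ∈ 𝔄, a * b = b * a)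
    {E : Type v} [TopologicalSpace E] [LocallyCompactSpace E]
    (F : 𝔄 →⋆ₙₐ[ℂ] BoundedContinuousFunction E ℂ) (hF : Function.Injective F)
    (T : ExtHaagerup.Tensor 𝔄 𝔄) :
    T.transform h𝔄 F ∈ ExtHaagerup.tensorFunctions.{u, v} (Set.range F) ∧
      [ExtHaagerup.IsPositiveMap T.op,
        ExtHaagerup.IsCompletelyPositiveMap T.op,
        ExtHaagerup.IsPositiveDefinite (T.transform h𝔄 F)].TFAE := by
  obtain ⟨t, rfl⟩ := Quotient.exists_rep T
  refine ⟨t.eval_mem_tensorFunctions h𝔄 F, ?_⟩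
  change [ExtHaagerup.IsPositiveMap t.op, ExtHaagerup.IsCompletelyPositiveMap t.op,
    ExtHaagerup.IsPositiveDefinite (t.eval F)].TFAE
  tfae_have 1 → 2 := fun h => ExtHaagerup.isCompletelyPositiveMap_of_sum_inner_nonneg h
    fun n X hX ξ => t.sum_inner_nonneg hcomm h X hX ξ
  tfae_have 2 → 1 := fun h => h.isPositiveMap
  tfae_have 1 → 3 := fun h => t.isPositiveDefinite_of_form_nonneg h𝔄 F
    (t.form_nonneg_of_isPositiveMap h𝔄 hcomm h)
  tfae_have 3 → 1 := fun h => t.isPositiveMap_of_form_nonneg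
    (t.form_nonneg_of_isPositiveDefinite h𝔄 hF h)
  tfae_finish
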